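/- Let $d\ge 1$, let $X$ be a complex Banach space, let $1<p_0,p_1\le\infty$ and $\gamma_0,\gamma_1>-d$, and put $w_0(x)=|x|^{\gamma_0}$, $w_1(x)=|x|^{\gamma_1}$ for $x\in\mathbb R^d$. For $p<\infty$ let $\|f\|_{L^p(\mathbb R^d,w;X)}=\big(\int_{\mathbb R^d}\|f(x)\|^p w(x)\,dx\big)^{1/p}\in[0,\infty]$, and let $L^\infty(\mathbb R^d,w;X)=L^\infty(\mathbb R^d;X)$; the norm of a distribution is the norm of the locally integrable function representing it, and $\infty$ if there is none. With the convention $a/\infty=0$, suppose that $$\frac{\gamma_1}{p_1}\le\frac{\gamma_0}{p_0}\qquad\text{and}\qquad \frac{d+\gamma_1}{p_1}<\frac{d+\gamma_0}{p_0},$$ and set $\delta=\frac{d+\gamma_0}{p_0}-\frac{d+\gamma_1}{p_1}>0$. Then for every multi-index $\alpha\in\mathbb N_0^d$ there is a constant $C_\alpha$ such that for all $t>0$ and all locally integrable functions $f:\mathbb R^d\to X$ which define an $X$-valued tempered distribution whose Fourier transform $\widehat f$ (normalized by $\widehat f(\xi)=(2\pi)^{-d/2}\int_{\mathbb R^d}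 f(x)e^{-ix\cdot\xi}\,dx$ for Schwartz functions $f$) satisfies $\operatorname{supp}(\widehat f)\subseteq\{\xi\in\mathbb R^d:|\xi|<t\}$ in the sense of distributions, one has $$\|D^\alpha f\|_{L^{p_1}(\mathbb R^d,w_1;X)}\le C_\alpha\, t^{|\alpha|+\delta}\,\|f\|_{L^{p_0}(\mathbb R^d,w_0;X)},$$ where $D^\alpha f$ is the distributional derivative. -/

import Mathlib

open MeasureTheory
open scoped ENNReal NNReal SchwartzMap FourierTransform LineDeriv

noncomputable section

namespace WeightedNikolskii

/-- The norm `‖f‖_{L^p(ℝ^d, |x|^γ; X)}`, with values in `[0, ∞]`. For `p = ∞` the weight plays no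
role: `L^∞(ℝ^d, w; X)` is the unweighted space `L^∞(ℝ^d; X)`. -/
def weightedLpNorm {d : ℕ} {X : Type*} [NormedAddCommGroup X] (p : ℝ≥0∞) (γ : ℝ)
    (f : EuclideanSpace ℝ (Fin d) → X) : ℝ≥0∞ :=
  if p = ∞ then eLpNorm f ∞ volume
  else eLpNorm f p (volume.withDensity fun x => ENNReal.ofReal (‖x‖ ^ γ))

/-- The `X`-valued tempered distribution `T` is the locally integrable function `f`, in the sense
of distributions: `T φ = ∫ φ(x) f(x) dx` for all test functions `φ ∈ C_c^∞(ℝ^d)`. -/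
def IsRepresentedBy {d : ℕ} {X : Type*} [NormedAddCommGroup X] [NormedSpace ℂ X]
    (T : 𝓢'(EuclideanSpace ℝ (Fin d), X)) (f : EuclideanSpace ℝ (Fin d) → X) : Prop :=
  LocallyIntegrable f volume ∧
    ∀ φ : 𝓢(EuclideanSpace ℝ (Fin d), ℂ), HasCompactSupport φ → T φ = ∫ x, φ x • f x

/-- The norm `‖T‖_{L^p(ℝ^d, |x|^γ; X)}` of a tempered distribution: the norm of the locally
integrable function (unique almost everywhere) that represents `T`, and `∞` if there is none. -/
def distLpNorm {d : ℕ} {X : Type*} [NormedAddCommGroup X] [NormedSpace ℂ X] (p : ℝ≥0∞) (γ : ℝ)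
    (T : 𝓢'(EuclideanSpace ℝ (Fin d), X)) : ℝ≥0∞ :=
  ⨅ (g : EuclideanSpace ℝ (Fin d) → X) (_ : IsRepresentedBy T g), weightedLpNorm p γ g

/-- The distributional derivative `D^α T = ∂_1^{α_1} ⋯ ∂_d^{α_d} T` for a multi-index `α`. -/
def multiDeriv {d : ℕ} {X : Type*} [NormedAddCommGroup X] [NormedSpace ℂ X] (α : Fin d → ℕ)
    (T : 𝓢'(EuclideanSpace ℝ (Fin d), X)) : 𝓢'(EuclideanSpace ℝ (Fin d), X) :=
  (List.finRange d).foldr (fun i S => (∂_{EuclideanSpace.single i (1 : ℝ)})^[α i] S) T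

/-- The distributional support of the Fourier transform of `T` lies in `{ξ : |ξ| < t}`, where the
Fourier transform is normalized by `e^{-i x·ξ}`. Mathlib's `𝓕` uses `e^{-2πi x·ξ}`, which rescales
the frequency variable by `2π`. -/
def HasFourierSupportInBall {d : ℕ} {X : Type*} [NormedAddCommGroup X] [NormedSpace ℂ X]
    (T : 𝓢'(EuclideanSpace ℝ (Fin d), X)) (t : ℝ) : Prop :=
  Distribution.dsupport (𝓕 T : 𝓢'(EuclideanSpace ℝ (Fin d), X)) ⊆
    Metric.ball (0 : EuclideanSpace ℝ (Fin d)) (t / (2 * Real.pi))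

end WeightedNikolskii

end

/-! Convolution with a Schwartz kernel whose Fourier multiplier is 1 on the frequency ball
reproduces `T` (`apply_eq_apply_conv`). Hence every derivative of `T` is `f` integrated against a
differentiated kernel (`IsConvolved.multiDeriv`). Dilation reduces the estimate to t = 1: the kernel
contributes t^|α|, and the scaling of the two norms contributes t^δ.

At unit scale Hölder's inequality is not available near the origin: for large γ₀ the dual weight of
|x|^γ₀ is not locally integrable. Instead, the identity `f = corr φ f` bounds |f| near 0 by its own
integral over a small ball plus a tail integral. Integrating this over the ball, whose volume is
small, absorbs the first term (`exists_enorm_corr_le_lintegral_compl_ball`). Away from 0, Peetre's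
inequality moves the weight from y to x, and Jensen's inequality gives (`exists_enorm_corr_le`) |D^α
f(x)| ≤ C (1+|x|)^(-γ₀/p₀) V(x)^(1/p₀), where V is |f|^p₀ |y|^γ₀ integrated against a decaying
kernel.

Both the L^1 and the L^∞ norm of V are at most a constant times the p₀-th power of the norm of f. If
p₁ = ∞, the first exponent condition says γ₀ ≥ 0 and the sup bound suffices. If p₁ < ∞, the unit
ball uses γ₁ > -d. Outside it, a decaying factor times V^(p₁/p₀) is integrated by interpolation when
p₁ ≥ p₀, and by Hölder with δ > 0 when p₁ < p₀ (`exists_lintegral_bracket_weight_le`). -/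

noncomputable section

namespace WeightedNikolskii

open Filter Topology Set
open scoped ContDiff

/-! ### Density of compactly supported test functions in the Schwartz space. -/

section Cutoff

variable {E : Type*} [NormedAddCommGroup E] [InnerProductSpace ℝ E] [FiniteDimensional ℝ E]

/-- All derivatives of `x ↦ χ (a • x) - 1` are `O(a ‖x‖)`, uniformly in `a ≤ 1`: they are bounded,
and vanish for `a ‖x‖ < 1`. -/
theorem norm_iteratedFDeriv_bump_sub_one_le (χ : ContDiffBump (0 : E)) (hχ : χ.rIn = 1) (i : ℕ) :
    ∃ B : ℝ, 0 ≤ B ∧ ∀ a : ℝ, 0 < a → a ≤ 1 → ∀ x : E,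
      ‖iteratedFDeriv ℝ i (fun y : E => χ (a • y) - 1) x‖ ≤ B * (a * ‖x‖) := by
  obtain ⟨B, hB⟩ := (χ.hasCompactSupport.toSchwartzMap χ.contDiff).decay 0 i
  have hg : ContDiff ℝ ∞ (fun y : E => χ y - 1) := χ.contDiff.sub contDiff_const
  refine ⟨B + 1, by linarith [hB.1], fun a ha ha1 x => ?_⟩
  have hB0 := hB.1
  by_cases hx : a * ‖x‖ < 1
  · have h0 : (fun y : E => χ (a • y) - 1) =ᶠ[𝓝 x] fun _ => (0 : ℝ) := by
      have : ∀ᶠ y in 𝓝 x, a * ‖y‖ < 1 :=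
        (continuous_const.mul continuous_norm).continuousAt.eventually_lt_const hx
      filter_upwards [this] with y hy
      rw [χ.one_of_mem_closedBall, sub_self]
      rw [mem_closedBall_zero_iff, norm_smul, Real.norm_eq_abs, abs_of_pos ha, hχ]
      exact hy.le
    rw [(h0.iteratedFDeriv ℝ i).eq_of_nhds]
    have : iteratedFDeriv ℝ i (fun _ : E => (0 : ℝ)) x = 0 := by
      simp [iteratedFDeriv_fun_zero]
    rw [this, norm_zero]
    positivity
  · push Not at hx
    have h1 : ‖iteratedFDeriv ℝ i (fun y : E => χ (a • y) - 1) x‖ ≤ B + 1 := by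
      rw [iteratedFDeriv_comp_const_smul (f := fun y : E => χ y - 1) a
        (hg.of_le (mod_cast le_top))]
      dsimp only
      rw [norm_smul, norm_pow, Real.norm_eq_abs, abs_of_pos ha]
      have h2 : ‖iteratedFDeriv ℝ i (fun y : E => χ y - 1) (a • x)‖ ≤ B + 1 := by
        rw [show (fun y : E => χ y - 1) = (χ : E → ℝ) - fun _ => (1 : ℝ) from rfl,
          iteratedFDeriv_sub_apply χ.contDiffAt contDiffAt_const]
        refine (norm_sub_le _ _).trans (add_le_add ?_ ?_)
        · have h3 := hB.2 (a • x)
          rw [pow_zero, one_mul] at h3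
          exact h3
        · rcases Nat.eq_zero_or_pos i with rfl | hi
          · simp
          · rw [iteratedFDeriv_const_of_ne hi.ne']
            simp
      calc _ ≤ 1 * (B + 1) := by
            gcongr
            exact pow_le_one₀ ha.le ha1
        _ = B + 1 := one_mul _
    calc _ ≤ B + 1 := h1
      _ = (B + 1) * 1 := (mul_one _).symm
      _ ≤ _ := by gcongr

/-- Schwartz functions are limits of compactly supported Schwartz functions. -/
theorem exists_hasCompactSupport_tendsto (η : 𝓢(E, ℂ)) :
    ∃ u : ℕ → 𝓢(E, ℂ), (∀ n, HasCompactSupport (u n)) ∧ (∀ n, tsupport (u n) ⊆ tsupport η) ∧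
      (∀ n x, ‖u n x‖ ≤ ‖η x‖) ∧ Tendsto u atTop (𝓝 η) := by
  let χ : ContDiffBump (0 : E) := ⟨1, 2, one_pos, one_lt_two⟩
  let a : ℕ → ℝ := fun n => ((n : ℝ) + 1)⁻¹
  have ha : ∀ n, 0 < a n := fun n => by positivity
  have ha1 : ∀ n, a n ≤ 1 := fun n => inv_le_one_of_one_le₀ (by linarith [n.cast_nonneg (α := ℝ)])
  have hc : ∀ n, HasCompactSupport (fun x : E => χ (a n • x)) := fun n =>
    χ.hasCompactSupport.comp_smul (ha n).ne'
  have hs : ∀ n, ContDiff ℝ ∞ (fun x : E => χ (a n • x)) := fun n =>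
    χ.contDiff.comp (contDiff_const_smul (a n))
  have hηs : ContDiff ℝ ∞ η := η.smooth ⊤
  let u : ℕ → 𝓢(E, ℂ) := fun n =>
    ((hc n).smul_right (f' := η)).toSchwartzMap ((hs n).smul hηs)
  have hu : ∀ n x, u n x = χ (a n • x) • η x := fun n x => rfl
  refine ⟨u, fun n => (hc n).smul_right, fun n => ?_, fun n x => ?_, ?_⟩
  · exact closure_mono fun x hx => by
      rw [Function.mem_support, hu] at hx
      exact fun h => hx (by rw [h, smul_zero])
  · rw [hu, norm_smul, Real.norm_eq_abs, abs_of_nonneg χ.nonneg]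
    exact mul_le_of_le_one_left (norm_nonneg _) χ.le_one
  · rw [(schwartz_withSeminorms ℝ E ℂ).tendsto_nhds u η]
    rintro ⟨k, m⟩ ε hε
    choose B hB0 hB using fun i => norm_iteratedFDeriv_bump_sub_one_le χ rfl i
    set S : ℝ := ∑ i ∈ Finset.range (m + 1),
      (m.choose i : ℝ) * B i * SchwartzMap.seminorm ℝ (k + 1) (m - i) η with hS
    have hS0 : 0 ≤ S := Finset.sum_nonneg fun i _ =>
      mul_nonneg (mul_nonneg (Nat.cast_nonneg _) (hB0 i)) (apply_nonneg _ _)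
    -- The factor `a n * ‖x‖` from the cutoff gives the smallness, at the cost of one more power of
    -- ‖x‖, hence seminorms of order `k + 1`.
    have key : ∀ n, SchwartzMap.seminorm ℝ k m (u n - η) ≤ a n * S := fun n => by
      refine SchwartzMap.seminorm_le_bound ℝ k m _ (mul_nonneg (ha n).le hS0) fun x => ?_
      have hcoe : ⇑(u n - η) = fun x => (χ (a n • x) - 1) • η x := by
        ext x
        simp [hu, sub_smul]
      rw [hcoe]
      have hle := norm_iteratedFDeriv_smul_le (𝕜 := ℝ) ((hs n).sub (contDiff_const (c := (1 : ℝ))))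
        hηs x (n := m) (mod_cast le_top)
      calc _ ≤ ‖x‖ ^ k * ∑ i ∈ Finset.range (m + 1), (m.choose i : ℝ) *
            ‖iteratedFDeriv ℝ i (fun y : E => χ (a n • y) - 1) x‖ *
              ‖iteratedFDeriv ℝ (m - i) η x‖ := by gcongr
        _ ≤ ‖x‖ ^ k * ∑ i ∈ Finset.range (m + 1), (m.choose i : ℝ) *
            (B i * (a n * ‖x‖)) * ‖iteratedFDeriv ℝ (m - i) η x‖ := by
          gcongr with i hi
          exact hB i _ (ha n) (ha1 n) x
        _ = a n * ∑ i ∈ Finset.range (m + 1), (m.choose i : ℝ) * B i *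
            (‖x‖ ^ (k + 1) * ‖iteratedFDeriv ℝ (m - i) η x‖) := by
          rw [Finset.mul_sum, Finset.mul_sum]
          refine Finset.sum_congr rfl fun i _ => by ring
        _ ≤ a n * S := by
          refine mul_le_mul_of_nonneg_left (Finset.sum_le_sum fun i _ => ?_) (ha n).le
          exact mul_le_mul_of_nonneg_left (SchwartzMap.le_seminorm ℝ _ _ _ _)
            (mul_nonneg (Nat.cast_nonneg _) (hB0 i))
    have hlim : Tendsto (fun n => a n * S) atTop (𝓝 0) := by
      have : Tendsto a atTop (𝓝 0) := by
        simpa [a, one_div] using tendsto_one_div_add_atTop_nhds_zero_nat (𝕜 := ℝ)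
      simpa using this.mul_const S
    filter_upwards [hlim.eventually_lt_const hε] with n hn
    exact (key n).trans_lt hn

end Cutoff

/-! ### Distributional support and non-compactly supported test functions. -/

section Support

variable {E : Type*} [NormedAddCommGroup E] [InnerProductSpace ℝ E] [FiniteDimensional ℝ E]
  {X : Type*} [NormedAddCommGroup X] [NormedSpace ℂ X]

/-- Splitting a test function supported in `U ∪ V`. -/
theorem apply_eq_zero_of_tsupport_subset_union {S : 𝓢'(E, X)} {U V : Set E} (hU : IsOpen U)
    (hV : IsOpen V)
    (hSU : ∀ η : 𝓢(E, ℂ), HasCompactSupport η → tsupport η ⊆ U → S η = 0)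
    (hSV : ∀ η : 𝓢(E, ℂ), HasCompactSupport η → tsupport η ⊆ V → S η = 0)
    (η : 𝓢(E, ℂ)) (hη : HasCompactSupport η) (hUV : tsupport η ⊆ U ∪ V) : S η = 0 := by
  have hA : IsClosed Uᶜ := hU.isClosed_compl
  have hB : IsClosed (tsupport η \ V) := (isClosed_tsupport _).sdiff hV
  have hd : Disjoint Uᶜ (tsupport η \ V) := by
    rw [Set.disjoint_left]
    rintro x hxU ⟨hx, hxV⟩
    exact (hUV hx).elim hxU hxV
  -- `f` vanishes near the complement of `U` and equals 1 near `tsupport η \ V`, so `f • η` lives in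
  -- `U` and the remainder in `V`.
  obtain ⟨f, hf0, hf1, -⟩ := exists_contMDiffMap_zero_one_nhds_of_isClosed
    (n := ⊤) (modelWithCornersSelf ℝ E) hA hB hd
  have hfs : ContDiff ℝ ∞ f := f.contMDiff.contDiff
  have hηs : ContDiff ℝ ∞ η := η.smooth ⊤
  let v : 𝓢(E, ℂ) := (hη.smul_left (f := f)).toSchwartzMap (hfs.smul hηs)
  have hv : ∀ x, v x = f x • η x := fun x => rfl
  have hvη : tsupport v ⊆ tsupport η := closure_mono fun x hx => by
    rw [Function.mem_support, hv] at hx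
    exact fun h => hx (by rw [h, smul_zero])
  have hvU : tsupport v ⊆ U := by
    intro x hx
    by_contra hxU
    refine notMem_tsupport_iff_eventuallyEq.mpr ?_ hx
    filter_upwards [hf0.filter_mono (nhds_le_nhdsSet hxU)] with y hy
    simp [hv, hy]
  have hwV : tsupport (η - v : 𝓢(E, ℂ)) ⊆ V := by
    intro x hx
    by_contra hxV
    refine notMem_tsupport_iff_eventuallyEq.mpr ?_ hx
    by_cases hxη : x ∈ tsupport η
    · have hx' : x ∈ tsupport η \ V := ⟨hxη, hxV⟩
      filter_upwards [hf1.filter_mono (nhds_le_nhdsSet hx')] with y hy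
      simp [hv, hy]
    · filter_upwards [notMem_tsupport_iff_eventuallyEq.mp hxη] with y hy
      simp [hv, hy]
  have hw : HasCompactSupport (η - v : 𝓢(E, ℂ)) := by
    have := hη.sub (hη.smul_left (f := f))
    exact this
  have h1 := hSV _ hw hwV
  have h2 : S v = 0 := hSU v (hη.smul_left (f := f)) hvU
  rwa [map_sub, h2, sub_zero] at h1

/-- A tempered distribution vanishes on Schwartz functions supported away from its support. -/
theorem apply_eq_zero_of_disjoint_dsupport (S : 𝓢'(E, X)) (η : 𝓢(E, ℂ))
    (h : Disjoint (tsupport η) (Distribution.dsupport S)) : S η = 0 := by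
  have hcpt : ∀ u : 𝓢(E, ℂ), HasCompactSupport u →
      Disjoint (tsupport u) (Distribution.dsupport S) → S u = 0 := by
    intro u hu hd
    obtain ⟨U, -, hKU, hU⟩ : ∃ U : Set E, IsOpen U ∧ tsupport u ⊆ U ∧
        ∀ w : 𝓢(E, ℂ), HasCompactSupport w → tsupport w ⊆ U → S w = 0 := by
      -- Compact induction plays the role of a partition of unity: only the union of two open sets
      -- has to be treated.
      refine IsCompact.induction_on (p := fun K => ∃ U : Set E, IsOpen U ∧ K ⊆ U ∧
        ∀ w : 𝓢(E, ℂ), HasCompactSupport w → tsupport w ⊆ U → S w = 0) hu ?_ ?_ ?_ ?_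
      · refine ⟨∅, isOpen_empty, Subset.rfl, fun w _ hw => ?_⟩
        have : w = 0 := by
          ext x
          exact image_eq_zero_of_notMem_tsupport fun hx => hw hx
        rw [this, map_zero]
      · rintro s t hst ⟨U, hUo, htU, hU⟩
        exact ⟨U, hUo, hst.trans htU, hU⟩
      · rintro s t ⟨U, hUo, hsU, hU⟩ ⟨V, hVo, htV, hV⟩
        exact ⟨U ∪ V, hUo.union hVo, union_subset_union hsU htV,
          fun w hw hwUV => apply_eq_zero_of_tsupport_subset_union hUo hVo hU hV w hw hwUV⟩
      · intro x hx
        obtain ⟨s, hs, hso, hxs⟩ :=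
          (Distribution.notMem_dsupport_iff x).mp (Set.disjoint_left.mp hd hx)
        exact ⟨s, mem_nhdsWithin_of_mem_nhds (hso.mem_nhds hxs), s, hso, Subset.rfl,
          fun w _ hw => hs w hw⟩
    exact hU u hu hKU
  obtain ⟨u, hu, huη, -, hlim⟩ := exists_hasCompactSupport_tendsto η
  have h1 : Tendsto (fun n => S (u n)) atTop (𝓝 (S η)) := (S.continuous.tendsto η).comp hlim
  have h2 : ∀ n, S (u n) = 0 := fun n => hcpt _ (hu n) (h.mono_left (huη n))
  simp only [h2] at h1
  exact tendsto_nhds_unique h1 tendsto_const_nhds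

end Support

/-! ### Dilations of Schwartz functions. -/

section Dilate

variable {E : Type*} [NormedAddCommGroup E] [InnerProductSpace ℝ E]

/-- The dilation `x ↦ ψ (t x)` of a Schwartz function. -/
def dilate (t : ℝˣ) : 𝓢(E, ℂ) →L[ℂ] 𝓢(E, ℂ) :=
  SchwartzMap.compCLMOfContinuousLinearEquiv ℂ (ContinuousLinearEquiv.smulLeft t)

@[simp]
theorem dilate_apply (t : ℝˣ) (ψ : 𝓢(E, ℂ)) (x : E) : dilate t ψ x = ψ ((t : ℝ) • x) := rfl

theorem lineDerivOp_dilate (t : ℝˣ) (ψ : 𝓢(E, ℂ)) (v : E) :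
    ∂_{v} (dilate t ψ) = ((t : ℝ) : ℂ) • dilate t (∂_{v} ψ) := by
  rw [dilate, SchwartzMap.lineDerivOp_compCLMOfContinuousLinearEquiv]
  ext x
  simp [SchwartzMap.lineDerivOp_apply_eq_fderiv, Units.smul_def]

end Dilate

/-! ### Reproducing kernels and their derivatives. -/

section Reproducing

variable {E : Type*} [NormedAddCommGroup E] [InnerProductSpace ℝ E] [FiniteDimensional ℝ E]
  [MeasurableSpace E] [BorelSpace E]
  {X : Type*} [NormedAddCommGroup X] [NormedSpace ℂ X]

/-- The convolution of two scalar Schwartz functions. -/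
abbrev conv (κ η : 𝓢(E, ℂ)) : 𝓢(E, ℂ) :=
  SchwartzMap.convolution (ContinuousLinearMap.mul ℂ ℂ) κ η

theorem conv_apply (κ η : 𝓢(E, ℂ)) (y : E) : conv κ η y = ∫ x, κ (y - x) * η x := by
  rw [conv, SchwartzMap.convolution_apply, convolution_eq_swap]
  rfl

theorem fourierInv_conv_apply (κ η : 𝓢(E, ℂ)) (ξ : E) :
    𝓕⁻ (conv κ η) ξ = 𝓕⁻ κ ξ * 𝓕⁻ η ξ := by
  simp only [SchwartzMap.fourierInv_apply_eq, conv, SchwartzMap.fourier_convolution]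
  simp

/-- Both sides have the same Fourier transform. This moves derivatives from the test function to the
kernel. -/
theorem conv_lineDerivOp (κ η : 𝓢(E, ℂ)) (v : E) : conv κ (∂_{v} η) = conv (∂_{v} κ) η := by
  have h : 𝓕 (conv κ (∂_{v} η)) = 𝓕 (conv (∂_{v} κ) η) := by
    have hv : (fun x : E => inner ℝ x v).HasTemperateGrowth :=
      ((innerSL ℝ).flip v).hasTemperateGrowth
    ext ξ
    simp only [conv, SchwartzMap.fourier_convolution, SchwartzMap.fourier_lineDerivOp_eq]
    simp [SchwartzMap.smulLeftCLM_apply_apply hv]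
    ring
  have := congrArg (fun u : 𝓢(E, ℂ) => 𝓕⁻ u) h
  simpa using this

/-- A distribution with Fourier support in a ball is reproduced by convolution with any kernel
whose Fourier transform is `1` there. -/
theorem apply_eq_apply_conv {T : 𝓢'(E, X)} {r : ℝ}
    (hT : Distribution.dsupport (𝓕 T : 𝓢'(E, X)) ⊆ Metric.ball (0 : E) r) {κ : 𝓢(E, ℂ)}
    (hκ : ∀ ξ ∈ Metric.ball (0 : E) r, 𝓕⁻ κ ξ = 1) (η : 𝓢(E, ℂ)) : T η = T (conv κ η) := by
  have h0 : (𝓕 T : 𝓢'(E, X)) (𝓕⁻ (η - conv κ η)) = 0 := by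
    refine apply_eq_zero_of_disjoint_dsupport _ _ ?_
    -- Since the ball is open, vanishing on it already keeps the closed support out of it; no margin
    -- around the spectrum is needed.
    have hcl : tsupport (𝓕⁻ (η - conv κ η) : 𝓢(E, ℂ)) ⊆ (Metric.ball (0 : E) r)ᶜ := by
      refine closure_minimal ?_ Metric.isOpen_ball.isClosed_compl
      intro ξ hξ hξr
      refine hξ ?_
      have hsub : 𝓕⁻ (η - conv κ η) = 𝓕⁻ η - 𝓕⁻ (conv κ η) :=
        map_sub (FourierTransform.fourierInvCLM ℂ 𝓢(E, ℂ)) _ _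
      rw [hsub, sub_apply, fourierInv_conv_apply, hκ ξ hξr,
        one_mul, sub_self]
    exact (Set.disjoint_compl_left_iff_subset.mpr hT).mono_left hcl
  rw [TemperedDistribution.fourier_apply, FourierTransform.fourier_fourierInv_eq, map_sub,
    sub_eq_zero] at h0
  exact h0

theorem fourierInv_dilate_apply {t : ℝˣ} (ht : 0 < (t : ℝ)) (ψ : 𝓢(E, ℂ)) (ξ : E) :
    𝓕⁻ (((t : ℝ) : ℂ) ^ Module.finrank ℝ E • dilate t ψ) ξ = 𝓕⁻ ψ ((t : ℝ)⁻¹ • ξ) := by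
  rw [FourierTransform.fourierInv_smul, smul_apply, SchwartzMap.fourierInv_coe,
    SchwartzMap.fourierInv_coe, Real.fourierInv_eq', Real.fourierInv_eq']
  have h := Measure.integral_comp_smul_of_nonneg (volume : Measure E)
    (fun v => Complex.exp (↑(2 * Real.pi * inner ℝ v ((t : ℝ)⁻¹ • ξ)) * Complex.I) • ψ v) (t : ℝ)
    (hR := ht.le)
  have h2 : (∫ v, Complex.exp (↑(2 * Real.pi * inner ℝ v ξ) * Complex.I) • dilate t ψ v) =
      ∫ v, Complex.exp (↑(2 * Real.pi * inner ℝ ((t : ℝ) • v) ((t : ℝ)⁻¹ • ξ)) * Complex.I) •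
        ψ ((t : ℝ) • v) := by
    refine integral_congr_ae (Eventually.of_forall fun v => ?_)
    simp only [dilate_apply, real_inner_smul_left, real_inner_smul_right]
    rw [inv_mul_cancel_left₀ ht.ne']
  rw [h2, h]
  have : ((t : ℝ) : ℂ) ^ Module.finrank ℝ E ≠ 0 := pow_ne_zero _ (by exact_mod_cast ht.ne')
  rw [Complex.real_smul]
  push_cast
  rw [smul_eq_mul, mul_inv_cancel_left₀ this]

variable (E) in
theorem exists_fourierInv_eq_one (r : ℝ) :
    ∃ φ : 𝓢(E, ℂ), ∀ ξ : E, ‖ξ‖ < r → 𝓕⁻ φ ξ = 1 := by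
  -- The maximum with 1 keeps the inner radius positive for every real `r`.
  let χ : ContDiffBump (0 : E) := ⟨max r 1, max r 1 + 1, by positivity, by linarith⟩
  have hc : HasCompactSupport (fun x => (χ x : ℂ)) := 
    χ.hasCompactSupport.comp_left (g := fun x : ℝ => (x : ℂ)) rfl
  have hs : ContDiff ℝ ∞ (fun x => (χ x : ℂ)) := Complex.ofRealCLM.contDiff.comp χ.contDiff
  refine ⟨𝓕 (hc.toSchwartzMap hs), fun ξ hξ => ?_⟩
  rw [FourierTransform.fourierInv_fourier_eq]
  change (χ ξ : ℂ) = 1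
  rw [χ.one_of_mem_closedBall (by
    rw [mem_closedBall_zero_iff]
    exact hξ.le.trans (le_max_left _ _)), Complex.ofReal_one]

/-- `S` is the convolution of `T` with the kernel `t ^ k ψ (t ·)`. -/
def IsConvolved (T : 𝓢'(E, X)) (t : ℝˣ) (k : ℕ) (S : 𝓢'(E, X)) (ψ : 𝓢(E, ℂ)) : Prop :=
  ∀ η : 𝓢(E, ℂ), S η = T (conv (((t : ℝ) : ℂ) ^ k • dilate t ψ) η)

/-- The sign is that of distributional differentiation by duality; the extra power of `t` is the
chain rule for the dilated kernel. -/
theorem IsConvolved.lineDerivOp {T S : 𝓢'(E, X)} {t : ℝˣ} {k : ℕ} {ψ : 𝓢(E, ℂ)}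
    (h : IsConvolved T t k S ψ) (v : E) : IsConvolved T t (k + 1) (∂_{v} S) (-∂_{v} ψ) := by
  intro η
  have hneg : conv (((t : ℝ) : ℂ) ^ k • dilate t ψ) (-∂_{v} η) =
      -conv (((t : ℝ) : ℂ) ^ k • dilate t ψ) (∂_{v} η) := map_neg _ _
  rw [TemperedDistribution.lineDerivOp_apply_apply, h, hneg, conv_lineDerivOp,
    LineDeriv.lineDerivOp_smul, lineDerivOp_dilate, smul_smul, ← pow_succ, map_neg,
    map_neg, smul_neg]
  simp [conv]

theorem IsConvolved.iterate_lineDerivOp {T S : 𝓢'(E, X)} {t : ℝˣ} {k : ℕ} {ψ : 𝓢(E, ℂ)}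
    (h : IsConvolved T t k S ψ) (v : E) (m : ℕ) :
    IsConvolved T t (k + m) ((∂_{v})^[m] S) ((fun u : 𝓢(E, ℂ) => -∂_{v} u)^[m] ψ) := by
  induction m with
  | zero => exact h
  | succ m ih =>
    rw [Function.iterate_succ_apply', Function.iterate_succ_apply', ← add_assoc]
    exact ih.lineDerivOp v

end Reproducing

/-! ### Multi-index derivatives of the kernel. -/

section MultiDeriv

variable {d : ℕ} {X : Type*} [NormedAddCommGroup X] [NormedSpace ℂ X]

/-- The signed derivative `(-1)^|α| D^α φ` of a kernel. -/
def kernelDeriv (α : Fin d → ℕ) (φ : 𝓢(EuclideanSpace ℝ (Fin d), ℂ)) :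
    𝓢(EuclideanSpace ℝ (Fin d), ℂ) :=
  (List.finRange d).foldr (fun i ψ =>
    (fun u : 𝓢(EuclideanSpace ℝ (Fin d), ℂ) => -∂_{EuclideanSpace.single i (1 : ℝ)} u)^[α i] ψ) φ

theorem IsConvolved.multiDeriv {T : 𝓢'(EuclideanSpace ℝ (Fin d), X)} {t : ℝˣ} {k : ℕ}
    {φ : 𝓢(EuclideanSpace ℝ (Fin d), ℂ)} (h : IsConvolved T t k T φ) (α : Fin d → ℕ) :
    IsConvolved T t (k + ∑ i, α i) (multiDeriv α T) (kernelDeriv α φ) := by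
  have key : ∀ l : List (Fin d), IsConvolved T t (k + (l.map α).sum)
      (l.foldr (fun i S => (∂_{EuclideanSpace.single i (1 : ℝ)})^[α i] S) T)
      (l.foldr (fun i ψ => (fun u : 𝓢(EuclideanSpace ℝ (Fin d), ℂ) =>
        -∂_{EuclideanSpace.single i (1 : ℝ)} u)^[α i] ψ) φ) := by
    intro l
    induction l with
    | nil => simpa using h
    | cons i l ih =>
      have := ih.iterate_lineDerivOp (EuclideanSpace.single i (1 : ℝ)) (α i)
      rw [List.map_cons, List.sum_cons, add_comm (α i), ← add_assoc]
      exact this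
  have := key (List.finRange d)
  rwa [← List.ofFn_eq_map, List.sum_ofFn] at this

end MultiDeriv

/-! ### Peetre's inequality and decay of Schwartz kernels. -/

section Peetre

variable {E : Type*} [NormedAddCommGroup E]

theorem continuous_one_add_norm_rpow (a : ℝ) : Continuous fun x : E => (1 + ‖x‖) ^ a :=
  (continuous_const.add continuous_norm).rpow_const
    fun x => Or.inl (by positivity : (0 : ℝ) < 1 + ‖x‖).ne'

theorem one_add_norm_le_mul (x y : E) : 1 + ‖y‖ ≤ (1 + ‖x‖) * (1 + ‖x - y‖) := by
  have h : ‖y‖ ≤ ‖x‖ + ‖x - y‖ := by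
    simpa using norm_sub_le x (x - y)
  nlinarith [mul_nonneg (norm_nonneg x) (norm_nonneg (x - y))]

theorem one_add_norm_rpow_le_mul (a : ℝ) (x y : E) :
    (1 + ‖y‖) ^ a ≤ (1 + ‖x‖) ^ a * (1 + ‖x - y‖) ^ |a| := by
  have hx : 0 < 1 + ‖x‖ := by positivity
  have hy : 0 < 1 + ‖y‖ := by positivity
  have hxy : 0 < 1 + ‖x - y‖ := by positivity
  rcases le_total 0 a with ha | ha
  · rw [abs_of_nonneg ha, ← Real.mul_rpow hx.le hxy.le]
    exact Real.rpow_le_rpow hy.le (one_add_norm_le_mul x y) ha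
  · have h : 1 + ‖x‖ ≤ (1 + ‖y‖) * (1 + ‖x - y‖) := by
      simpa [norm_sub_rev] using one_add_norm_le_mul y x
    have h2 := Real.rpow_le_rpow_of_nonpos hx h ha
    rw [Real.mul_rpow hy.le hxy.le] at h2
    calc (1 + ‖y‖) ^ a = (1 + ‖y‖) ^ a * (1 + ‖x - y‖) ^ a * (1 + ‖x - y‖) ^ |a| := by
          rw [abs_of_nonpos ha, mul_assoc, ← Real.rpow_add hxy, add_neg_cancel, Real.rpow_zero,
            mul_one]
      _ ≤ _ := by gcongr

variable [NormedSpace ℝ E]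

theorem schwartz_norm_le_rpow (ψ : 𝓢(E, ℂ)) (N : ℝ) :
    ∃ C : ℝ, 0 ≤ C ∧ ∀ x, ‖ψ x‖ ≤ C * (1 + ‖x‖) ^ (-N) := by
  obtain ⟨k, hk⟩ := exists_nat_ge N
  refine ⟨2 ^ k * (Finset.Iic (k, 0)).sup (fun m => SchwartzMap.seminorm ℝ m.1 m.2) ψ,
    mul_nonneg (by positivity) (apply_nonneg _ _), fun x => ?_⟩
  have h := SchwartzMap.one_add_le_sup_seminorm_apply (𝕜 := ℝ) (m := (k, 0)) le_rfl le_rfl ψ x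
  rw [norm_iteratedFDeriv_zero] at h
  have hx : 0 < 1 + ‖x‖ := by positivity
  have h1 : (1 + ‖x‖) ^ N * ‖ψ x‖ ≤ (1 + ‖x‖) ^ k * ‖ψ x‖ := by
    gcongr
    rw [← Real.rpow_natCast]
    exact Real.rpow_le_rpow_of_exponent_le (by linarith [norm_nonneg x]) hk
  rw [Real.rpow_neg hx.le, ← div_eq_mul_inv, le_div_iff₀ (by positivity), mul_comm]
  exact h1.trans h

/-- Peetre's inequality separates the variables: polynomial growth in `x` times a function of `y`
that is integrable for tempered `f`. Absolute convergence and Fubini below rest on this domination.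
-/
theorem norm_schwartz_smul_le {X : Type*} [NormedAddCommGroup X] [NormedSpace ℂ X]
    {f : E → X} {N : ℝ} (hN : 0 ≤ N) (κ : 𝓢(E, ℂ)) : ∃ C : ℝ, 0 ≤ C ∧ ∀ x y : E,
      ‖κ (y - x) • f y‖ ≤ C * (1 + ‖x‖) ^ N * ((1 + ‖y‖) ^ (-N) * ‖f y‖) := by
  obtain ⟨C, hC, hκ⟩ := schwartz_norm_le_rpow κ N
  refine ⟨C, hC, fun x y => ?_⟩
  have h := one_add_norm_rpow_le_mul (-N) y (y - x)
  have h2 : (1 + ‖y - x‖) ^ (-N) ≤ (1 + ‖y‖) ^ (-N) * (1 + ‖x‖) ^ N := by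
    simpa [abs_of_nonneg hN] using h
  rw [norm_smul]
  calc _ ≤ C * (1 + ‖y - x‖) ^ (-N) * ‖f y‖ := by gcongr; exact hκ _
    _ ≤ C * ((1 + ‖y‖) ^ (-N) * (1 + ‖x‖) ^ N) * ‖f y‖ := by gcongr
    _ = _ := by ring

end Peetre

/-! ### Tempered functions and their correlation with Schwartz kernels. -/

section Tempered

variable {E : Type*} [NormedAddCommGroup E] [InnerProductSpace ℝ E] [FiniteDimensional ℝ E]
  [MeasurableSpace E] [BorelSpace E] {X : Type*} [NormedAddCommGroup X]

/-- A function which is integrable against a negative power of `1 + |x|`. -/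
def IsTemperedFun (f : E → X) : Prop :=
  AEStronglyMeasurable f ∧ ∃ N : ℝ, 0 ≤ N ∧ Integrable fun y => (1 + ‖y‖) ^ (-N) * ‖f y‖

/-- Locally integrable functions in a weighted Lebesgue space are tempered. -/
theorem isTemperedFun_of_lintegral_lt_top {f : E → X} (hf : LocallyIntegrable f) {p γ : ℝ}
    (hp : 1 ≤ p) (h : ∫⁻ y, ‖f y‖ₑ ^ p * ENNReal.ofReal (‖y‖ ^ γ) < ⊤) : IsTemperedFun f := by
  refine ⟨hf.aestronglyMeasurable, |γ| + Module.finrank ℝ E + 1, by positivity, ?_⟩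
  -- The `|γ|` makes the decaying factor at most `‖y‖ ^ γ` off the unit ball; the rest makes it
  -- integrable, for the region where `‖f‖ ≤ 1`.
  set N : ℝ := |γ| + Module.finrank ℝ E + 1 with hN
  have hN0 : 0 ≤ N := by positivity
  refine ⟨(continuous_one_add_norm_rpow _).aestronglyMeasurable.mul
    hf.aestronglyMeasurable.norm, ?_⟩
  have hpt : ∀ y : E, ‖(1 + ‖y‖) ^ (-N) * ‖f y‖‖ₑ ≤
      (Metric.closedBall (0 : E) 1).indicator (fun y => ‖f y‖ₑ) y +
        (ENNReal.ofReal ((1 + ‖y‖) ^ (-N)) + ‖f y‖ₑ ^ p * ENNReal.ofReal (‖y‖ ^ γ)) := by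
    intro y
    have hy0 : 0 ≤ (1 + ‖y‖) ^ (-N) := by positivity
    have hy1 : (1 + ‖y‖) ^ (-N) ≤ 1 :=
      Real.rpow_le_one_of_one_le_of_nonpos (by linarith [norm_nonneg y]) (by linarith)
    rw [enorm_mul, enorm_norm, Real.enorm_of_nonneg hy0]
    by_cases hy : ‖y‖ ≤ 1
    · rw [Set.indicator_of_mem (by simpa using hy)]
      refine le_add_right ?_
      calc _ ≤ 1 * ‖f y‖ₑ := by
            gcongr
            simpa using hy1
        _ = _ := one_mul _
    · refine le_add_left ?_
      push Not at hy
      have hwy : (1 + ‖y‖) ^ (-N) ≤ ‖y‖ ^ γ := by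
        calc (1 + ‖y‖) ^ (-N) ≤ (1 + ‖y‖) ^ (-|γ|) :=
              Real.rpow_le_rpow_of_exponent_le (by linarith) (by
                rw [hN]; linarith [(Module.finrank ℝ E).cast_nonneg (α := ℝ)])
          _ ≤ ‖y‖ ^ (-|γ|) := Real.rpow_le_rpow_of_nonpos (by linarith) (by linarith)
                (by linarith [abs_nonneg γ])
          _ ≤ ‖y‖ ^ γ := Real.rpow_le_rpow_of_exponent_le hy.le (neg_abs_le γ)
      rcases le_total ‖f y‖ₑ 1 with h1 | h1
      · refine le_add_right ?_
        calc _ ≤ ENNReal.ofReal ((1 + ‖y‖) ^ (-N)) * 1 := by gcongr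
          _ = _ := mul_one _
      · refine le_add_left ?_
        rw [mul_comm]
        gcongr
        calc ‖f y‖ₑ = ‖f y‖ₑ ^ (1 : ℝ) := (ENNReal.rpow_one _).symm
          _ ≤ _ := ENNReal.rpow_le_rpow_of_exponent_le h1 hp
  rw [hasFiniteIntegral_iff_enorm]
  refine (lintegral_mono hpt).trans_lt ?_
  have hm : Measurable fun y : E => ENNReal.ofReal ((1 + ‖y‖) ^ (-N)) :=
    (continuous_one_add_norm_rpow _).measurable.ennreal_ofReal
  rw [lintegral_add_left' (hf.aestronglyMeasurable.enorm.indicator measurableSet_closedBall),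
    lintegral_add_left hm]
  refine ENNReal.add_lt_top.mpr ⟨?_, ENNReal.add_lt_top.mpr ⟨?_, h⟩⟩
  · rw [lintegral_indicator measurableSet_closedBall]
    exact (hf.integrableOn_isCompact (isCompact_closedBall 0 1)).2
  · exact finite_integral_one_add_norm (by rw [hN]; linarith [abs_nonneg γ])

variable [NormedSpace ℂ X]

/-- The correlation `x ↦ ∫ κ (y - x) f y dy`. -/
def corr (κ : 𝓢(E, ℂ)) (f : E → X) (x : E) : X := ∫ y, κ (y - x) • f y

theorem IsTemperedFun.integrable_smul {f : E → X} (hf : IsTemperedFun f) (κ : 𝓢(E, ℂ)) (x : E) :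
    Integrable fun y => κ (y - x) • f y := by
  obtain ⟨hm, N, hN, hi⟩ := hf
  obtain ⟨C, hC, h⟩ := norm_schwartz_smul_le (f := f) hN κ
  refine (hi.const_mul (C * (1 + ‖x‖) ^ N)).mono' ?_ (Eventually.of_forall fun y => h x y)
  exact (κ.continuous.comp (continuous_id.sub continuous_const)).aestronglyMeasurable.smul hm

theorem IsTemperedFun.integrable_prod {f : E → X} (hf : IsTemperedFun f) (κ η : 𝓢(E, ℂ)) :
    Integrable (fun z : E × E => η z.1 • κ (z.2 - z.1) • f z.2) (volume.prod volume) := by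
  obtain ⟨hm, N, hN, hi⟩ := hf
  obtain ⟨C, hC, h⟩ := norm_schwartz_smul_le (f := f) hN κ
  -- `N` cancels the growth of the kernel bound in the first variable; dimension plus one leaves an
  -- integrable factor.
  obtain ⟨C', hC', hη⟩ := schwartz_norm_le_rpow η (N + (Module.finrank ℝ E + 1))
  have hfr : (Module.finrank ℝ E : ℝ) < Module.finrank ℝ E + 1 := by linarith
  have hdom := ((integrable_one_add_norm (μ := (volume : Measure E)) hfr).const_mul
    (C' * C)).mul_prod hi
  refine hdom.mono' ?_ (Eventually.of_forall fun z => ?_)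
  · refine (η.continuous.comp continuous_fst).aestronglyMeasurable.smul ?_
    exact (κ.continuous.comp (continuous_snd.sub continuous_fst)).aestronglyMeasurable.smul
      hm.comp_snd
  · rw [norm_smul]
    have hz : 0 < 1 + ‖z.1‖ := by positivity
    calc _ ≤ (C' * (1 + ‖z.1‖) ^ (-(N + (Module.finrank ℝ E + 1)))) *
          (C * (1 + ‖z.1‖) ^ N * ((1 + ‖z.2‖) ^ (-N) * ‖f z.2‖)) := by
          gcongr
          · exact hη _
          · exact h _ _
      _ = C' * C * ((1 + ‖z.1‖) ^ (-(N + (Module.finrank ℝ E + 1))) * (1 + ‖z.1‖) ^ N) *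
          ((1 + ‖z.2‖) ^ (-N) * ‖f z.2‖) := by ring
      _ = _ := by
        rw [← Real.rpow_add hz]
        congr 4
        ring

/-- Fubini: a convolution acting on the test function becomes a correlation acting on `f`. -/
theorem IsTemperedFun.integral_conv_smul [CompleteSpace X] {f : E → X} (hf : IsTemperedFun f)
    (κ η : 𝓢(E, ℂ)) :
    ∫ y, conv κ η y • f y = ∫ x, η x • corr κ f x := by
  have h1 : ∀ x, η x • corr κ f x = ∫ y, η x • κ (y - x) • f y := fun x => by
    rw [corr, integral_smul]
  have h2 : ∀ y, conv κ η y • f y = ∫ x, η x • κ (y - x) • f y := fun y => by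
    rw [conv_apply, ← integral_smul_const]
    simp only [smul_smul, mul_comm]
  simp only [h1, h2]
  exact (integral_integral_swap (hf.integrable_prod κ η)).symm

theorem IsTemperedFun.locallyIntegrable_corr {f : E → X} (hf : IsTemperedFun f)
    (κ : 𝓢(E, ℂ)) : LocallyIntegrable (corr κ f) := by
  obtain ⟨hm, N, hN, hi⟩ := id hf
  obtain ⟨C, hC, h⟩ := norm_schwartz_smul_le (f := f) hN κ
  have hcont : Continuous fun x : E => C * (1 + ‖x‖) ^ N * ∫ y, (1 + ‖y‖) ^ (-N) * ‖f y‖ :=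
    (continuous_const.mul (continuous_one_add_norm_rpow N)).mul continuous_const
  refine hcont.locallyIntegrable.mono ?_ (Eventually.of_forall fun x => ?_)
  · have : AEStronglyMeasurable (fun z : E × E => κ (z.2 - z.1) • f z.2)
        ((volume : Measure E).prod volume) :=
      (κ.continuous.comp (continuous_snd.sub continuous_fst)).aestronglyMeasurable.smul
        hm.comp_snd
    exact this.integral_prod_right'
  · refine le_trans ?_ (Real.le_norm_self _)
    rw [corr, ← integral_const_mul]
    exact norm_integral_le_of_norm_le (hi.const_mul _) (Eventually.of_forall fun y => h x y)

end Tempered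

/-! ### Representing functions of convolved distributions, and their uniqueness. -/

section Represented

variable {d : ℕ} {X : Type*} [NormedAddCommGroup X] [NormedSpace ℂ X]

/-- A representing tempered function represents on all Schwartz functions. -/
theorem IsRepresentedBy.apply_eq_integral {T : 𝓢'(EuclideanSpace ℝ (Fin d), X)}
    {f : EuclideanSpace ℝ (Fin d) → X} (hT : IsRepresentedBy T f) (hf : IsTemperedFun f)
    (η : 𝓢(EuclideanSpace ℝ (Fin d), ℂ)) : T η = ∫ x, η x • f x := by
  obtain ⟨u, hu, -, hle, hlim⟩ := exists_hasCompactSupport_tendsto η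
  have h1 : Tendsto (fun n => T (u n)) atTop (𝓝 (T η)) := (T.continuous.tendsto η).comp hlim
  have h2 : Tendsto (fun n => ∫ x, u n x • f x) atTop (𝓝 (∫ x, η x • f x)) := by
    have hηf : Integrable fun x => η x • f x := by
      simpa using hf.integrable_smul η 0
    refine tendsto_integral_of_dominated_convergence (fun x => ‖η x • f x‖) (fun n => ?_)
      hηf.norm (fun n => Eventually.of_forall fun x => ?_) (Eventually.of_forall fun x => ?_)
    · exact (u n).continuous.aestronglyMeasurable.smul hf.1
    · rw [norm_smul, norm_smul]
      gcongr
      exact hle n x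
    · have : Tendsto (fun n => u n x) atTop (𝓝 (η x)) :=
        ((TemperedDistribution.delta x).continuous.tendsto η).comp hlim
      exact this.smul_const _
  refine tendsto_nhds_unique h1 (h2.congr fun n => ?_)
  exact (hT.2 _ (hu n)).symm

/-- Convolutions of a represented distribution are represented by the correlation. -/
theorem IsConvolved.isRepresentedBy [CompleteSpace X] {T S : 𝓢'(EuclideanSpace ℝ (Fin d), X)}
    {f : EuclideanSpace ℝ (Fin d) → X} (hT : IsRepresentedBy T f) (hf : IsTemperedFun f)
    {t : ℝˣ} {k : ℕ} {ψ : 𝓢(EuclideanSpace ℝ (Fin d), ℂ)} (h : IsConvolved T t k S ψ) :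
    IsRepresentedBy S (corr (((t : ℝ) : ℂ) ^ k • dilate t ψ) f) :=
  ⟨hf.locallyIntegrable_corr _, fun η _ => by
    rw [h, hT.apply_eq_integral hf, hf.integral_conv_smul]⟩

theorem IsRepresentedBy.ae_eq {T : 𝓢'(EuclideanSpace ℝ (Fin d), X)} [CompleteSpace X]
    {f g : EuclideanSpace ℝ (Fin d) → X} (hf : IsRepresentedBy T f) (hg : IsRepresentedBy T g) :
    f =ᵐ[volume] g := by
  refine ae_eq_of_integral_contDiff_smul_eq hf.1 hg.1 fun u hu hc => ?_
  have hc' : HasCompactSupport (fun x => (u x : ℂ)) :=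
    hc.comp_left (g := fun x : ℝ => (x : ℂ)) rfl
  have hs' : ContDiff ℝ ∞ (fun x => (u x : ℂ)) := Complex.ofRealCLM.contDiff.comp hu
  have h := (hf.2 (hc'.toSchwartzMap hs') hc').symm.trans (hg.2 (hc'.toSchwartzMap hs') hc')
  simpa using h

end Represented

/-! ### Calculus of the decaying weight. -/

section Bracket

variable {E : Type*} [NormedAddCommGroup E]

/-- The decaying weight `(1 + |z|)^(-N)`, as an extended nonnegative number. -/
def bracket (N : ℝ) (z : E) : ℝ≥0∞ := ENNReal.ofReal ((1 + ‖z‖) ^ (-N))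

theorem bracket_ne_top (N : ℝ) (z : E) : bracket N z ≠ ⊤ := ENNReal.ofReal_ne_top

theorem measurable_bracket [MeasurableSpace E] [BorelSpace E] (N : ℝ) :
    Measurable (bracket N : E → ℝ≥0∞) :=
  (continuous_one_add_norm_rpow _).measurable.ennreal_ofReal

theorem bracket_le_one {N : ℝ} (hN : 0 ≤ N) (z : E) : bracket N z ≤ 1 := by
  rw [bracket, ENNReal.ofReal_le_one]
  exact Real.rpow_le_one_of_one_le_of_nonpos (by linarith [norm_nonneg z]) (by linarith)

/-- Peetre's inequality again; it turns a tail integral centred at 0 into one centred at `x`. -/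
theorem bracket_mul_bracket_le {N : ℝ} (hN : 0 ≤ N) (x y : E) :
    bracket N x * bracket N y ≤ bracket N (y - x) := by
  rw [bracket, bracket, bracket, ← ENNReal.ofReal_mul (by positivity)]
  refine ENNReal.ofReal_le_ofReal ?_
  rw [← Real.mul_rpow (by positivity) (by positivity)]
  refine Real.rpow_le_rpow_of_nonpos (by positivity) ?_ (by linarith)
  have := one_add_norm_le_mul x (x - y)
  rwa [norm_sub_rev, sub_sub_cancel] at this

/-- For `y` in the unit ball, translation by `y` changes the bracket by at most `2 ^ N`. -/
theorem bracket_sub_le {N : ℝ} (hN : 0 ≤ N) {x y : E} (hy : ‖y‖ ≤ 1) :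
    bracket N (x - y) ≤ ENNReal.ofReal (2 ^ N) * bracket N x := by
  rw [bracket, bracket, ← ENNReal.ofReal_mul (by positivity)]
  refine ENNReal.ofReal_le_ofReal ?_
  have h := one_add_norm_rpow_le_mul (-N) x (x - y)
  rw [sub_sub_cancel, abs_neg, abs_of_nonneg hN, mul_comm] at h
  refine h.trans ?_
  gcongr
  linarith

theorem bracket_neg (N : ℝ) (z : E) : bracket N (-z) = bracket N z := by
  rw [bracket, norm_neg, bracket]

/-- Moving a power weight through a decaying kernel, away from the origin. -/
theorem bracket_le_mul {ε : ℝ} (hε : 0 < ε) (M a : ℝ) (x : E) {y : E} (hy : ε ≤ ‖y‖) :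
    bracket (M + |a|) (y - x) ≤ ENNReal.ofReal ((1 + ε⁻¹) ^ |a|) * bracket a x *
      (bracket M (y - x) * ENNReal.ofReal (‖y‖ ^ a)) := by
  have hy0 : 0 < ‖y‖ := hε.trans_le hy
  have hx1 : 0 < 1 + ‖x‖ := by positivity
  have hyx : 0 < 1 + ‖y - x‖ := by positivity
  rw [bracket, bracket, bracket, ← ENNReal.ofReal_mul (by positivity),
    ← ENNReal.ofReal_mul (by positivity), ← ENNReal.ofReal_mul (by positivity)]
  refine ENNReal.ofReal_le_ofReal ?_
  have h1 := one_add_norm_rpow_le_mul a y x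
  have h2 : (1 + ‖y‖) ^ a ≤ (1 + ε⁻¹) ^ |a| * ‖y‖ ^ a := by
    have h3 : 1 + ‖y‖ = (1 + ‖y‖⁻¹) * ‖y‖ := by field_simp; ring
    rw [h3, Real.mul_rpow (by positivity) hy0.le]
    gcongr
    calc (1 + ‖y‖⁻¹) ^ a ≤ (1 + ‖y‖⁻¹) ^ |a| :=
          Real.rpow_le_rpow_of_exponent_le (by linarith [inv_pos.mpr hy0]) (le_abs_self a)
      _ ≤ _ := by gcongr
  calc (1 + ‖y - x‖) ^ (-(M + |a|))
      = (1 + ‖x‖) ^ (-a) * (1 + ‖x‖) ^ a * (1 + ‖y - x‖) ^ (-(M + |a|)) := by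
        rw [← Real.rpow_add hx1, neg_add_cancel, Real.rpow_zero, one_mul]
    _ ≤ (1 + ‖x‖) ^ (-a) * (((1 + ε⁻¹) ^ |a| * ‖y‖ ^ a) * (1 + ‖y - x‖) ^ |a|) *
        (1 + ‖y - x‖) ^ (-(M + |a|)) := by
        gcongr
        exact h1.trans (by gcongr)
    _ = (1 + ‖x‖) ^ (-a) * ((1 + ε⁻¹) ^ |a| * ‖y‖ ^ a) * ((1 + ‖y - x‖) ^ |a| *
        (1 + ‖y - x‖) ^ (-(M + |a|))) := by ring
    _ = (1 + ‖x‖) ^ (-a) * ((1 + ε⁻¹) ^ |a| * ‖y‖ ^ a) * (1 + ‖y - x‖) ^ (-M) := by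
        rw [← Real.rpow_add hyx]
        congr 2
        ring
    _ = _ := by ring

theorem bracket_rpow {b s : ℝ} (hs : 0 ≤ s) (x : E) : bracket b x ^ s = bracket (b * s) x := by
  rw [bracket, bracket, ENNReal.ofReal_rpow_of_nonneg (by positivity) hs,
    ← Real.rpow_mul (by positivity), neg_mul]

theorem bracket_le_of_norm_le_one (a : ℝ) {x : E} (hx : ‖x‖ ≤ 1) :
    bracket a x ≤ ENNReal.ofReal (2 ^ |a|) := by
  refine ENNReal.ofReal_le_ofReal ?_
  calc (1 + ‖x‖) ^ (-a) ≤ (1 + ‖x‖) ^ |a| :=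
        Real.rpow_le_rpow_of_exponent_le (by linarith [norm_nonneg x]) (neg_le_abs a)
    _ ≤ _ := by gcongr; linarith

theorem norm_rpow_le_bracket (γ : ℝ) {x : E} (hx : 1 ≤ ‖x‖) :
    ENNReal.ofReal (‖x‖ ^ γ) ≤ ENNReal.ofReal (2 ^ |γ|) * bracket (-γ) x := by
  rw [bracket, neg_neg, ← ENNReal.ofReal_mul (by positivity)]
  refine ENNReal.ofReal_le_ofReal ?_
  have hx0 : 0 < ‖x‖ := by linarith
  rcases le_total 0 γ with h | h
  · calc ‖x‖ ^ γ ≤ 1 * (1 + ‖x‖) ^ γ := by rw [one_mul]; gcongr; linarith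
      _ ≤ _ := by
        gcongr
        exact Real.one_le_rpow one_le_two (abs_nonneg γ)
  · calc ‖x‖ ^ γ ≤ (2⁻¹ * (1 + ‖x‖)) ^ γ :=
          Real.rpow_le_rpow_of_nonpos (by positivity) (by linarith) h
      _ = _ := by
        rw [Real.mul_rpow (by positivity) (by positivity), abs_of_nonpos h,
          Real.inv_rpow zero_le_two, Real.rpow_neg zero_le_two]

theorem schwartz_enorm_le_bracket [NormedSpace ℝ E] (κ : 𝓢(E, ℂ)) (N : ℝ) :
    ∃ c : ℝ≥0, ∀ z, ‖κ z‖ₑ ≤ c * bracket N z := by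
  obtain ⟨C, hC, h⟩ := schwartz_norm_le_rpow κ N
  refine ⟨C.toNNReal, fun z => ?_⟩
  rw [bracket, ← ENNReal.ofReal, ← ENNReal.ofReal_mul hC, ← ofReal_norm]
  exact ENNReal.ofReal_le_ofReal (h z)

end Bracket

/-! ### Pointwise bounds by absorption near the origin. -/

section Pointwise

variable {E : Type*} [NormedAddCommGroup E] [InnerProductSpace ℝ E] [FiniteDimensional ℝ E]
  [MeasurableSpace E] [BorelSpace E] {X : Type*} [NormedAddCommGroup X]

/-- Finiteness of this integral is what permits its absorption below. -/
theorem IsTemperedFun.lintegral_ball_lt_top {f : E → X} (hf : IsTemperedFun f) {ε : ℝ}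
    (hε : ε ≤ 1) : ∫⁻ y in Metric.ball 0 ε, ‖f y‖ₑ < ⊤ := by
  obtain ⟨hm, N, hN, hi⟩ := hf
  calc ∫⁻ y in Metric.ball 0 ε, ‖f y‖ₑ
      ≤ ∫⁻ y in Metric.ball 0 ε, ENNReal.ofReal (2 ^ N) * ‖(1 + ‖y‖) ^ (-N) * ‖f y‖‖ₑ := by
        refine setLIntegral_mono' measurableSet_ball fun y hy => ?_
        rw [mem_ball_zero_iff] at hy
        have hy0 : 0 < 1 + ‖y‖ := by positivity
        rw [enorm_mul, enorm_norm, Real.enorm_of_nonneg (by positivity), ← mul_assoc,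
          ← ENNReal.ofReal_mul (by positivity)]
        refine le_mul_of_one_le_left (zero_le) ?_
        rw [ENNReal.one_le_ofReal, Real.rpow_neg hy0.le, ← div_eq_mul_inv,
          le_div_iff₀ (by positivity), one_mul]
        gcongr
        linarith
    _ ≤ ∫⁻ y, ENNReal.ofReal (2 ^ N) * ‖(1 + ‖y‖) ^ (-N) * ‖f y‖‖ₑ := setLIntegral_le_lintegral _ _
    _ < ⊤ := by
        rw [lintegral_const_mul' _ _ ENNReal.ofReal_ne_top]
        exact ENNReal.mul_lt_top ENNReal.ofReal_lt_top hi.2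

variable [NormedSpace ℂ X]

theorem enorm_corr_le (κ : 𝓢(E, ℂ)) (f : E → X) (x : E) :
    ‖corr κ f x‖ₑ ≤ ∫⁻ y, ‖κ (y - x)‖ₑ * ‖f y‖ₑ := by
  refine (enorm_integral_le_lintegral_enorm _).trans (le_of_eq ?_)
  simp only [enorm_smul]

/-- The values of a reproduced function near the origin are controlled by those away from it. -/
theorem exists_enorm_corr_le_lintegral_compl_ball [Nontrivial E] (φ ψ : 𝓢(E, ℂ)) {N : ℝ}
    (hN : 0 ≤ N) : ∃ ε : ℝ, 0 < ε ∧ ∃ C : ℝ≥0, ∀ f : E → X, IsTemperedFun f →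
      f =ᵐ[volume] corr φ f → ∀ x, ‖corr ψ f x‖ₑ ≤
        C * ∫⁻ y in (Metric.ball 0 ε)ᶜ, bracket N (y - x) * ‖f y‖ₑ := by
  obtain ⟨c₁, hφ⟩ := schwartz_enorm_le_bracket φ N
  obtain ⟨c₂, hψ⟩ := schwartz_enorm_le_bracket ψ N
  -- Outer regularity at the null set `{0}` yields a ball with `volume B * c₁ ≤ 1/2`. Its radius
  -- depends on `φ` and `N` only, not on `f`.
  have hc0 : (volume : Measure E) {0} < (2 * (c₁ + 1 : ℝ≥0∞))⁻¹ := by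
    rw [measure_singleton, ENNReal.inv_pos]
    finiteness
  obtain ⟨U, h0U, hUo, hUv⟩ := Set.exists_isOpen_lt_of_lt _ _ hc0
  obtain ⟨ε', hε', hball'⟩ := Metric.isOpen_iff.mp hUo 0 (h0U rfl)
  set ε := min ε' 1 with hε_def
  have hε : 0 < ε := lt_min hε' one_pos
  have hε1 : ε ≤ 1 := min_le_right _ _
  set B : Set E := Metric.ball 0 ε with hB
  have hBm : MeasurableSet B := measurableSet_ball
  have hvol : 2 * (volume B * c₁) ≤ 1 := by
    have h1 : volume B ≤ (2 * (c₁ + 1 : ℝ≥0∞))⁻¹ :=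
      (measure_mono ((Metric.ball_subset_ball (min_le_left _ _)).trans hball')).trans hUv.le
    calc 2 * (volume B * c₁) ≤ 2 * ((2 * (c₁ + 1 : ℝ≥0∞))⁻¹ * (c₁ + 1)) := by
          gcongr
          exact le_self_add
      _ = (2 * (c₁ + 1 : ℝ≥0∞)) * (2 * (c₁ + 1 : ℝ≥0∞))⁻¹ := by ring
      _ ≤ 1 := ENNReal.mul_inv_le_one _
  set D : ℝ≥0∞ := ENNReal.ofReal (2 ^ N) with hD
  refine ⟨ε, hε, c₂ * ((2 : ℝ) ^ N).toNNReal * ((2 : ℝ) ^ N).toNNReal + c₂, fun f hf hrep x => ?_⟩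
  have hfm : AEMeasurable (fun y => ‖f y‖ₑ) := hf.1.enorm
  set J : ℝ≥0∞ := ∫⁻ y in Bᶜ, bracket N y * ‖f y‖ₑ with hJ
  set L : ℝ≥0∞ := ∫⁻ y in B, ‖f y‖ₑ with hL
  have hLtop : L < ⊤ := hf.lintegral_ball_lt_top hε1
  have hsplit : ∀ (κ : 𝓢(E, ℂ)) (c : ℝ≥0), (∀ z, ‖κ z‖ₑ ≤ c * bracket N z) → ∀ z : E,
      ‖corr κ f z‖ₑ ≤ c * (∫⁻ y in B, bracket N (y - z) * ‖f y‖ₑ) +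
        c * ∫⁻ y in Bᶜ, bracket N (y - z) * ‖f y‖ₑ := by
    intro κ c hκ z
    rw [← mul_add, lintegral_add_compl _ hBm, ← lintegral_const_mul' _ _ ENNReal.coe_ne_top]
    refine (enorm_corr_le κ f z).trans (lintegral_mono fun y => ?_)
    rw [← mul_assoc]
    gcongr
    exact hκ _
  have hnear : ∀ z ∈ B, ‖corr φ f z‖ₑ ≤ c₁ * (L + D * J) := by
    intro z hz
    have hz1 : ‖z‖ ≤ 1 := (mem_ball_zero_iff.mp hz).le.trans hε1
    refine (hsplit φ c₁ hφ z).trans ?_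
    rw [mul_add]
    gcongr
    · refine lintegral_mono fun y => ?_
      calc _ ≤ 1 * ‖f y‖ₑ := by gcongr; exact bracket_le_one hN _
        _ = _ := one_mul _
    · rw [hJ, ← lintegral_const_mul' _ _ ENNReal.ofReal_ne_top]
      refine lintegral_mono fun y => ?_
      rw [← mul_assoc]
      gcongr
      exact bracket_sub_le hN hz1
  -- Integrating the bound for `f = corr φ f` over `B` gives `2 * L ≤ L + D * J`, and the finite `L`
  -- cancels.
  have hLJ : L ≤ D * J := by
    have h1 : L ≤ volume B * (c₁ * (L + D * J)) := by
      calc L = ∫⁻ y in B, ‖corr φ f y‖ₑ := by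
            refine lintegral_congr_ae ?_
            filter_upwards [ae_restrict_of_ae hrep] with y hy
            rw [← hy]
        _ ≤ ∫⁻ _ in B, c₁ * (L + D * J) := setLIntegral_mono' hBm hnear
        _ = _ := by rw [setLIntegral_const, mul_comm]
    have h2 : L + L ≤ L + D * J := by
      calc L + L = 2 * L := (two_mul L).symm
        _ ≤ 2 * (volume B * (c₁ * (L + D * J))) := by gcongr
        _ = 2 * (volume B * c₁) * (L + D * J) := by ring
        _ ≤ 1 * (L + D * J) := by gcongr
        _ = _ := one_mul _
    exact (ENNReal.add_le_add_iff_left hLtop.ne).mp h2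
  set I : ℝ≥0∞ := ∫⁻ y in Bᶜ, bracket N (y - x) * ‖f y‖ₑ with hI
  -- The absorbed bound is centred at 0; the factor `bracket N x`, available from the kernel for `y`
  -- in `B`, recentres it at `x`.
  have hJI : bracket N x * J ≤ I := by
    rw [hJ, ← lintegral_const_mul' _ _ (bracket_ne_top N x)]
    refine lintegral_mono fun y => ?_
    rw [← mul_assoc]
    gcongr
    exact bracket_mul_bracket_le hN x y
  have hnearx : ∫⁻ y in B, bracket N (y - x) * ‖f y‖ₑ ≤ D * D * I := by
    calc _ ≤ ∫⁻ y in B, (D * bracket N x) * ‖f y‖ₑ := by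
          refine setLIntegral_mono' hBm fun y hy => ?_
          gcongr
          rw [← bracket_neg, neg_sub]
          exact bracket_sub_le hN ((mem_ball_zero_iff.mp hy).le.trans hε1)
      _ = D * bracket N x * L := lintegral_const_mul' _ _
          (ENNReal.mul_ne_top ENNReal.ofReal_ne_top (bracket_ne_top _ _))
      _ ≤ D * bracket N x * (D * J) := by gcongr
      _ = D * D * (bracket N x * J) := by ring
      _ ≤ _ := by gcongr
  calc ‖corr ψ f x‖ₑ ≤ c₂ * (D * D * I) + c₂ * I := (hsplit ψ c₂ hψ x).trans (by gcongr)
    _ = _ := by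
      push_cast
      rw [← ENNReal.ofReal, ← hD]
      ring

/-- Jensen's inequality for a decaying kernel. -/
theorem lintegral_bracket_mul_le {M p : ℝ} (hp : 1 < p) {H : E → ℝ≥0∞} (hH : AEMeasurable H)
    (x : E) : ∫⁻ y, bracket M (y - x) * H y ≤
      (∫⁻ y : E, bracket M y) ^ (1 - 1 / p) *
        (∫⁻ y, bracket M (y - x) * H y ^ p) ^ (1 / p) := by
  set q := p.conjExponent with hq
  have hpq : p.HolderConjugate q := Real.HolderConjugate.conjExponent hp
  have hk : Measurable fun y : E => bracket M (y - x) :=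
    (measurable_bracket M).comp (measurable_id.sub_const x)
  have h := ENNReal.lintegral_mul_le_Lp_mul_Lq volume hpq.symm
    (f := fun y : E => bracket M (y - x) ^ (1 / q))
    (g := fun y => bracket M (y - x) ^ (1 / p) * H y)
    (hk.pow_const _).aemeasurable ((hk.pow_const _).aemeasurable.mul hH)
  have hsum : 1 / q + 1 / p = 1 := by
    simpa [one_div] using hpq.symm.inv_add_inv_eq_one
  have h1 : ∀ y : E, ((fun y : E => bracket M (y - x) ^ (1 / q)) *
      fun y => bracket M (y - x) ^ (1 / p) * H y) y = bracket M (y - x) * H y := by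
    intro y
    simp only [Pi.mul_apply]
    rw [← mul_assoc, ← ENNReal.rpow_add_of_nonneg _ _ (by have := hpq.symm.pos; positivity)
      (by positivity), hsum, ENNReal.rpow_one]
  have h2 : ∀ y : E, (bracket M (y - x) ^ (1 / q)) ^ q = bracket M (y - x) := fun y => by
    rw [← ENNReal.rpow_mul, one_div_mul_cancel hpq.symm.pos.ne', ENNReal.rpow_one]
  have h3 : ∀ y : E, (bracket M (y - x) ^ (1 / p) * H y) ^ p = bracket M (y - x) * H y ^ p :=
    fun y => by
      rw [ENNReal.mul_rpow_of_nonneg _ _ (by linarith), ← ENNReal.rpow_mul,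
        one_div_mul_cancel (by linarith), ENNReal.rpow_one]
  simp only [h1, h2, h3] at h
  rw [lintegral_sub_right_eq_self (fun y : E => bracket M y) x,
    show 1 / q = 1 - 1 / p by linarith] at h
  exact h

/-- The pointwise bound on derivatives of band-limited functions. -/
theorem exists_enorm_corr_le [Nontrivial E] (φ ψ : 𝓢(E, ℂ)) {p : ℝ} (hp : 1 < p) (γ : ℝ) {M : ℝ}
    (hM : (Module.finrank ℝ E : ℝ) < M) : ∃ C : ℝ≥0, ∀ f : E → X, IsTemperedFun f →
      f =ᵐ[volume] corr φ f → ∀ x, ‖corr ψ f x‖ₑ ≤ C * bracket (γ / p) x *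
        (∫⁻ y, bracket M (y - x) * (‖f y‖ₑ ^ p * ENNReal.ofReal (‖y‖ ^ γ))) ^ (1 / p) := by
  have hM0 : 0 ≤ M := (Nat.cast_nonneg _).trans hM.le
  have hp0 : p ≠ 0 := by linarith
  -- The extra decay `|γ / p|` is spent in `bracket_le_mul` on moving the weight from `y` to `x`;
  -- decay `M` remains for Jensen.
  obtain ⟨ε, hε, C, hC⟩ := exists_enorm_corr_le_lintegral_compl_ball (X := X) φ ψ
    (N := M + |γ / p|) (by positivity)
  have hK : ∫⁻ y : E, bracket M y < ⊤ := finite_integral_one_add_norm hM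
  set K : ℝ≥0∞ := (∫⁻ y : E, bracket M y) ^ (1 - 1 / p) with hKdef
  have hKtop : K ≠ ⊤ := by
    refine ENNReal.rpow_ne_top_of_nonneg ?_ hK.ne
    rw [sub_nonneg, div_le_one (by linarith)]
    exact hp.le
  refine ⟨C * ((1 + ε⁻¹) ^ |γ / p|).toNNReal * K.toNNReal, fun f hf hrep x => ?_⟩
  have hfm : AEMeasurable fun y => ‖f y‖ₑ := hf.1.enorm
  have hw : Measurable fun y : E => ENNReal.ofReal (‖y‖ ^ (γ / p)) :=
    (measurable_norm.pow_const _).ennreal_ofReal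
  set D : ℝ≥0∞ := ENNReal.ofReal ((1 + ε⁻¹) ^ |γ / p|) with hD
  have h1 : ∫⁻ y in (Metric.ball 0 ε)ᶜ, bracket (M + |γ / p|) (y - x) * ‖f y‖ₑ ≤
      D * bracket (γ / p) x *
        ∫⁻ y, bracket M (y - x) * (‖f y‖ₑ * ENNReal.ofReal (‖y‖ ^ (γ / p))) := by
    rw [← lintegral_const_mul' _ _ (ENNReal.mul_ne_top ENNReal.ofReal_ne_top (bracket_ne_top _ _))]
    refine (setLIntegral_mono' measurableSet_ball.compl fun y hy => ?_).trans
      (setLIntegral_le_lintegral _ _)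
    have hy' : ε ≤ ‖y‖ := by simpa using hy
    calc _ ≤ D * bracket (γ / p) x * (bracket M (y - x) * ENNReal.ofReal (‖y‖ ^ (γ / p))) *
          ‖f y‖ₑ := by gcongr; exact bracket_le_mul hε M (γ / p) x hy'
      _ = _ := by ring
  have h2 : ∀ y : E, (‖f y‖ₑ * ENNReal.ofReal (‖y‖ ^ (γ / p))) ^ p =
      ‖f y‖ₑ ^ p * ENNReal.ofReal (‖y‖ ^ γ) := fun y => by
    rw [ENNReal.mul_rpow_of_nonneg _ _ (by linarith),
      ENNReal.ofReal_rpow_of_nonneg (by positivity) (by linarith), ← Real.rpow_mul (norm_nonneg _),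
      div_mul_cancel₀ _ hp0]
  have h3 := lintegral_bracket_mul_le (M := M) hp (hfm.mul hw.aemeasurable) x
  simp only [Pi.mul_apply, h2] at h3
  calc ‖corr ψ f x‖ₑ ≤ C * (D * bracket (γ / p) x * (K * (∫⁻ y, bracket M (y - x) *
        (‖f y‖ₑ ^ p * ENNReal.ofReal (‖y‖ ^ γ))) ^ (1 / p))) := by
        refine (hC f hf hrep x).trans ?_
        gcongr
        refine h1.trans ?_
        gcongr
    _ = _ := by
      push_cast
      rw [ENNReal.coe_toNNReal hKtop, ← ENNReal.ofReal, ← hD]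
      ring

end Pointwise

/-! ### Integration against the target weight. -/

section Weighted

variable {E : Type*} [NormedAddCommGroup E] [InnerProductSpace ℝ E] [FiniteDimensional ℝ E]
  [MeasurableSpace E] [BorelSpace E]

theorem lintegral_norm_rpow_ball_lt_top [Nontrivial E] {γ : ℝ}
    (hγ : -(Module.finrank ℝ E : ℝ) < γ) :
    ∫⁻ x : E in Metric.ball 0 1, ENNReal.ofReal (‖x‖ ^ γ) < ⊤ := by
  have hn : 1 ≤ Module.finrank ℝ E := Module.finrank_pos
  have h : IntegrableOn (fun x : E => ‖x‖ ^ γ) (Metric.ball 0 1) := by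
    rw [integrableOn_fun_norm_addHaar volume (f := fun r => r ^ γ)]
    have h1 : IntegrableOn (fun r : ℝ => r ^ (γ + (Module.finrank ℝ E - 1 : ℕ))) (Ioo 0 1) := by
      rw [← integrableOn_Ioc_iff_integrableOn_Ioo,
        ← intervalIntegrable_iff_integrableOn_Ioc_of_le zero_le_one]
      refine intervalIntegral.intervalIntegrable_rpow' ?_
      push_cast [Nat.cast_sub hn]
      linarith
    refine h1.congr_fun (fun r hr => ?_) measurableSet_Ioo
    beta_reduce
    rw [Real.rpow_add_natCast hr.1.ne', smul_eq_mul, mul_comm]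
  have h2 := h.2
  rw [hasFiniteIntegral_iff_enorm] at h2
  refine lt_of_eq_of_lt (lintegral_congr fun x => ?_) h2
  rw [Real.enorm_of_nonneg (by positivity)]

/-- Integrating a power of `V ∈ L^1 ∩ L^∞` against a decaying weight. -/
theorem exists_lintegral_bracket_mul_rpow_le {b s : ℝ} (hs : 0 < s) (hb : 0 ≤ b)
    (hbs : Module.finrank ℝ E * (1 - s) < b) (K : ℝ≥0) :
    ∃ C : ℝ≥0, ∀ (V : E → ℝ≥0∞) (A : ℝ≥0∞), AEMeasurable V → (∀ x, V x ≤ A) →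
      ∫⁻ x, V x ≤ K * A → ∫⁻ x, bracket b x * V x ^ s ≤ C * A ^ s := by
  rcases le_or_gt 1 s with h1 | h1
  -- For `s ≥ 1`, drop the bracket and interpolate: `V ^ s ≤ A ^ (s - 1) * V`.
  · refine ⟨K, fun V A hVm hVA hV => ?_⟩
    calc ∫⁻ x, bracket b x * V x ^ s ≤ ∫⁻ x, A ^ (s - 1) * V x := by
          refine lintegral_mono fun x => ?_
          calc bracket b x * V x ^ s ≤ 1 * V x ^ ((s - 1) + 1) := by
                rw [sub_add_cancel]
                gcongr
                exact bracket_le_one hb x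
            _ = V x ^ (s - 1) * V x := by
                rw [one_mul, ENNReal.rpow_add_of_nonneg _ _ (by linarith) zero_le_one,
                  ENNReal.rpow_one]
            _ ≤ _ := by
                gcongr ?_ * _
                exact ENNReal.rpow_le_rpow (hVA x) (by linarith)
      _ ≤ A ^ (s - 1) * (K * A) := by
          rw [lintegral_const_mul'' _ hVm]
          gcongr
      _ = K * A ^ s := by
          have hA : A ^ s = A ^ (s - 1) * A := by
            conv_lhs => rw [show s = (s - 1) + 1 by ring]
            rw [ENNReal.rpow_add_of_nonneg _ _ (by linarith) zero_le_one, ENNReal.rpow_one]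
          rw [hA]
          ring
  -- For `s < 1`, Hölder with exponents `1 / s` and `1 / (1 - s)`; `hbs` says exactly that the
  -- bracket raised to `1 / (1 - s)` decays faster than the dimension.
  · have hs1 : 0 < 1 - s := by linarith
    have hpq : (1 / s).HolderConjugate (1 / (1 - s)) := by
      rw [Real.holderConjugate_iff]
      refine ⟨(one_lt_div hs).mpr h1, ?_⟩
      simp
    set Q : ℝ≥0∞ := (∫⁻ x : E, bracket (b * (1 / (1 - s))) x) ^ (1 - s) with hQ
    have hQtop : Q ≠ ⊤ := by
      refine ENNReal.rpow_ne_top_of_nonneg hs1.le (LT.lt.ne ?_)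
      refine finite_integral_one_add_norm ?_
      rw [mul_one_div, lt_div_iff₀ hs1]
      exact hbs
    refine ⟨K ^ s * Q.toNNReal, fun V A hVm _ hV => ?_⟩
    have h := ENNReal.lintegral_mul_le_Lp_mul_Lq volume hpq.symm (f := (bracket b : E → ℝ≥0∞))
      (g := fun x => V x ^ s) (measurable_bracket b).aemeasurable (hVm.pow_const s)
    have h2 : ∀ x, (V x ^ s) ^ (1 / s) = V x := fun x => by
      rw [← ENNReal.rpow_mul, mul_one_div_cancel hs.ne', ENNReal.rpow_one]
    have h3 : ∀ x : E, bracket b x ^ (1 / (1 - s)) = bracket (b * (1 / (1 - s))) x := fun x =>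
      bracket_rpow (by positivity) x
    simp only [h2, h3, one_div_one_div, Pi.mul_apply] at h
    rw [← hQ] at h
    calc _ ≤ Q * (∫⁻ x, V x) ^ s := h
      _ ≤ Q * (K * A) ^ s := by gcongr
      _ = _ := by
        rw [ENNReal.mul_rpow_of_nonneg _ _ hs.le]
        push_cast [ENNReal.coe_rpow_of_nonneg _ hs.le]
        rw [ENNReal.coe_toNNReal hQtop]
        ring

/-- The weighted estimate, for finite target exponent. -/
theorem exists_lintegral_bracket_weight_le [Nontrivial E] {p q γ₀ γ₁ : ℝ} (hp : 0 < p)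
    (hq : 0 < q) (hγ₁ : -(Module.finrank ℝ E : ℝ) < γ₁) (hγ : γ₁ / q ≤ γ₀ / p)
    (hδ : (Module.finrank ℝ E + γ₁) / q < (Module.finrank ℝ E + γ₀) / p) (K : ℝ≥0) :
    ∃ C : ℝ≥0, ∀ (V : E → ℝ≥0∞) (A : ℝ≥0∞), AEMeasurable V → (∀ x, V x ≤ A) →
      ∫⁻ x, V x ≤ K * A →
      ∫⁻ x, (bracket (γ₀ / p) x * V x ^ (1 / p)) ^ q * ENNReal.ofReal (‖x‖ ^ γ₁) ≤
        C * A ^ (q / p) := by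
  set n : ℝ := ((Module.finrank ℝ E : ℕ) : ℝ) with hn
  -- `b` is the decay left at infinity after the target weight is paid for. `hγ` amounts to `0 ≤ b`,
  -- and `hδ` to `n * (1 - q / p) < b`.
  set b : ℝ := γ₀ / p * q - γ₁ with hb_def
  have hb : 0 ≤ b := by
    rw [div_le_iff₀ hq] at hγ
    linarith
  have hbs : n * (1 - q / p) < b := by
    rw [div_lt_iff₀ hq] at hδ
    have : (n + γ₀) / p * q = n * (q / p) + γ₀ / p * q := by ring
    rw [this] at hδ
    rw [hb_def]
    linarith
  obtain ⟨C, hC⟩ := exists_lintegral_bracket_mul_rpow_le (E := E) (s := q / p) (by positivity)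
    hb hbs K
  set a : ℝ := γ₀ / p with ha
  set W : ℝ≥0∞ := ∫⁻ x : E in Metric.ball 0 1, ENNReal.ofReal (‖x‖ ^ γ₁) with hW
  have hWtop : W ≠ ⊤ := (lintegral_norm_rpow_ball_lt_top hγ₁).ne
  set D : ℝ≥0∞ := ENNReal.ofReal (2 ^ |a|) ^ q with hD
  have hDtop : D ≠ ⊤ := ENNReal.rpow_ne_top_of_nonneg hq.le ENNReal.ofReal_ne_top
  set D' : ℝ≥0∞ := ENNReal.ofReal (2 ^ |γ₁|) with hD'
  refine ⟨D.toNNReal * W.toNNReal + ((2 : ℝ) ^ |γ₁|).toNNReal * C, fun V A hVm hVA hV => ?_⟩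
  have hpow : ∀ x, (bracket a x * V x ^ (1 / p)) ^ q = bracket a x ^ q * V x ^ (q / p) := by
    intro x
    rw [ENNReal.mul_rpow_of_nonneg _ _ hq.le, ← ENNReal.rpow_mul, one_div_mul_eq_div]
  have hin : ∫⁻ x in Metric.ball 0 1,
      (bracket a x * V x ^ (1 / p)) ^ q * ENNReal.ofReal (‖x‖ ^ γ₁) ≤ D * W * A ^ (q / p) := by
    calc _ ≤ ∫⁻ x : E in Metric.ball 0 1, ENNReal.ofReal (‖x‖ ^ γ₁) * (D * A ^ (q / p)) := by
          refine setLIntegral_mono' measurableSet_ball fun x hx => ?_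
          rw [mem_ball_zero_iff] at hx
          rw [hpow, mul_comm]
          gcongr
          · exact ENNReal.rpow_le_rpow (bracket_le_of_norm_le_one a hx.le) hq.le
          · exact hVA x
      _ = W * (D * A ^ (q / p)) :=
          lintegral_mul_const _ (measurable_norm.pow_const _).ennreal_ofReal
      _ = _ := by ring
  have hout : ∫⁻ x in (Metric.ball 0 1)ᶜ,
      (bracket a x * V x ^ (1 / p)) ^ q * ENNReal.ofReal (‖x‖ ^ γ₁) ≤
        D' * (C * A ^ (q / p)) := by
    calc _ ≤ ∫⁻ x in (Metric.ball (0 : E) 1)ᶜ, D' * (bracket b x * V x ^ (q / p)) := by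
          refine setLIntegral_mono' measurableSet_ball.compl fun x hx => ?_
          have hx' : 1 ≤ ‖x‖ := by simpa using hx
          rw [hpow]
          have hbb : bracket b x = bracket a x ^ q * bracket (-γ₁) x := by
            rw [bracket_rpow hq.le, bracket, bracket, bracket,
              ← ENNReal.ofReal_mul (by positivity), ← Real.rpow_add (by positivity)]
            congr 2
            rw [hb_def]
            ring
          calc _ ≤ bracket a x ^ q * V x ^ (q / p) * (D' * bracket (-γ₁) x) := by
                gcongr
                exact norm_rpow_le_bracket γ₁ hx'
            _ = _ := by rw [hbb]; ring
      _ ≤ ∫⁻ x, D' * (bracket b x * V x ^ (q / p)) := setLIntegral_le_lintegral _ _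
      _ = D' * ∫⁻ x, bracket b x * V x ^ (q / p) := lintegral_const_mul' _ _ ENNReal.ofReal_ne_top
      _ ≤ _ := by gcongr; exact hC V A hVm hVA hV
  rw [← lintegral_add_compl _ (measurableSet_ball (x := (0 : E)) (ε := 1))]
  refine (add_le_add hin hout).trans (le_of_eq ?_)
  push_cast
  rw [ENNReal.coe_toNNReal hDtop, ENNReal.coe_toNNReal hWtop, ← ENNReal.ofReal, ← hD']
  ring

/-- Tonelli and translation invariance. This is the L^1 half of the control of V; the L^∞ half is
`bracket_le_one`. -/
theorem lintegral_lintegral_bracket_mul {M : ℝ} {g : E → ℝ≥0∞} (hg : AEMeasurable g) :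
    AEMeasurable (fun x => ∫⁻ y, bracket M (y - x) * g y) ∧
    ∫⁻ x, ∫⁻ y, bracket M (y - x) * g y = (∫⁻ y : E, bracket M y) * ∫⁻ y, g y := by
  have hm : AEMeasurable (fun z : E × E => bracket M (z.2 - z.1) * g z.2)
      ((volume : Measure E).prod volume) :=
    (((measurable_bracket M).comp (measurable_snd.sub measurable_fst)).aemeasurable).mul
      hg.comp_snd
  refine ⟨hm.lintegral_prod_right', ?_⟩
  rw [lintegral_lintegral_swap hm]
  have h : ∀ y : E, ∫⁻ x, bracket M (y - x) * g y = (∫⁻ z : E, bracket M z) * g y := fun y => by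
    have hy : Measurable fun x : E => bracket M (y - x) :=
      (measurable_bracket M).comp (measurable_id.const_sub y)
    rw [lintegral_mul_const _ hy,
      lintegral_sub_left_eq_self (fun z : E => bracket M z) y]
  simp only [h]
  rw [lintegral_const_mul'' _ hg]

end Weighted

/-! ### Reduction to unit frequency scale. -/

section Scaling

variable {E : Type*} [NormedAddCommGroup E] [InnerProductSpace ℝ E] [FiniteDimensional ℝ E]
  [MeasurableSpace E] [BorelSpace E] {X : Type*} [NormedAddCommGroup X]

theorem lintegral_comp_smul {t : ℝ} (ht : 0 < t) (F : E → ℝ≥0∞) :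
    ∫⁻ x, F (t • x) = ENNReal.ofReal (t ^ (-(Module.finrank ℝ E : ℝ))) * ∫⁻ x, F x := by
  have h := lintegral_map_equiv (μ := (volume : Measure E)) F
    (Homeomorph.smul (Units.mk0 t ht.ne')).toMeasurableEquiv
  have h2 := Measure.map_addHaar_smul (volume : Measure E) ht.ne'
  have h3 : Measure.map (Homeomorph.smul (Units.mk0 t ht.ne')).toMeasurableEquiv
      (volume : Measure E) = ENNReal.ofReal |(t ^ Module.finrank ℝ E)⁻¹| • volume := h2
  rw [h3, lintegral_smul_measure] at h
  rw [Real.rpow_neg ht.le, Real.rpow_natCast, ← abs_of_pos (a := (t ^ Module.finrank ℝ E)⁻¹)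
    (by positivity)]
  exact h.symm

theorem IsTemperedFun.comp_inv_smul {f : E → X} (hf : IsTemperedFun f) {t : ℝ} (ht : 0 < t) :
    IsTemperedFun fun x => f (t⁻¹ • x) := by
  obtain ⟨hm, N, hN, hi⟩ := hf
  have hq := Measure.quasiMeasurePreserving_smul (volume : Measure E) (inv_ne_zero ht.ne')
  refine ⟨hm.comp_quasiMeasurePreserving hq, N, hN, ?_⟩
  have h1 : Integrable fun z : E => (1 + t * ‖z‖) ^ (-N) * ‖f z‖ := by
    refine (hi.const_mul ((1 + t⁻¹) ^ N)).mono' ?_ (Eventually.of_forall fun z => ?_)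
    · refine Continuous.aestronglyMeasurable ?_ |>.mul hm.norm
      exact (continuous_const.add (continuous_const.mul continuous_norm)).rpow_const
        fun z => Or.inl (by positivity : (0 : ℝ) < 1 + t * ‖z‖).ne'
    · rw [Real.norm_of_nonneg (by positivity), ← mul_assoc]
      gcongr
      have h2 : 1 + ‖z‖ ≤ (1 + t⁻¹) * (1 + t * ‖z‖) := by
        have : (1 + t⁻¹) * (1 + t * ‖z‖) = 1 + ‖z‖ + (t * ‖z‖ + t⁻¹) := by field_simp; ring
        rw [this]
        have : 0 ≤ t * ‖z‖ + t⁻¹ := by positivity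
        linarith
      have h3 : (1 + ‖z‖) ^ N ≤ (1 + t⁻¹) ^ N * (1 + t * ‖z‖) ^ N := by
        rw [← Real.mul_rpow (by positivity) (by positivity)]
        gcongr
      rw [Real.rpow_neg (by positivity), Real.rpow_neg (by positivity), ← div_eq_mul_inv,
        le_div_iff₀ (by positivity), inv_mul_le_iff₀ (by positivity), mul_comm]
      exact h3
  have h4 := h1.comp_smul (inv_ne_zero ht.ne')
  refine h4.congr (Eventually.of_forall fun y => ?_)
  simp only [norm_smul, norm_inv, Real.norm_of_nonneg ht.le]
  rw [mul_inv_cancel_left₀ ht.ne']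

variable [NormedSpace ℂ X]

/-- The Jacobian of `y ↦ t y` cancels the dimensional power of `t`; the power `k` coming from
derivatives survives. -/
theorem corr_dilate {t : ℝˣ} (ht : 0 < (t : ℝ)) (ψ : 𝓢(E, ℂ)) (k : ℕ) (f : E → X) (x : E) :
    corr (((t : ℝ) : ℂ) ^ (Module.finrank ℝ E + k) • dilate t ψ) f x =
      ((t : ℝ) : ℂ) ^ k • corr ψ (fun z => f ((t : ℝ)⁻¹ • z)) ((t : ℝ) • x) := by
  have h := Measure.integral_comp_smul_of_nonneg (volume : Measure E)
    (fun z => ψ (z - (t : ℝ) • x) • f ((t : ℝ)⁻¹ • z)) (t : ℝ) (hR := ht.le)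
  have htc : ((t : ℝ) : ℂ) ^ Module.finrank ℝ E ≠ 0 := pow_ne_zero _ (by exact_mod_cast ht.ne')
  have h2 : ∀ y : E, (((t : ℝ) : ℂ) ^ (Module.finrank ℝ E + k) • dilate t ψ) (y - x) • f y =
      ((t : ℝ) : ℂ) ^ (Module.finrank ℝ E + k) •
        (ψ ((t : ℝ) • y - (t : ℝ) • x) • f ((t : ℝ)⁻¹ • (t : ℝ) • y)) := fun y => by
    rw [smul_apply, dilate_apply, smul_sub, smul_assoc, inv_smul_smul₀ ht.ne']
  rw [corr, corr]
  simp only [h2]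
  rw [integral_smul, h, ← Complex.coe_smul, smul_smul]
  congr 1
  push_cast
  rw [pow_add, mul_right_comm, mul_inv_cancel₀ htc, one_mul]

theorem ae_eq_corr_comp_inv_smul {t : ℝˣ} (ht : 0 < (t : ℝ)) {φ : 𝓢(E, ℂ)} {f : E → X}
    (h : f =ᵐ[volume] corr (((t : ℝ) : ℂ) ^ Module.finrank ℝ E • dilate t φ) f) :
    (fun z => f ((t : ℝ)⁻¹ • z)) =ᵐ[volume] corr φ (fun z => f ((t : ℝ)⁻¹ • z)) := by
  have hq := Measure.quasiMeasurePreserving_smul (volume : Measure E) (inv_ne_zero ht.ne')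
  filter_upwards [hq.ae h] with z hz
  have h1 := corr_dilate ht φ 0 f ((t : ℝ)⁻¹ • z)
  rw [add_zero, pow_zero, one_smul, smul_inv_smul₀ ht.ne'] at h1
  rw [← h1]
  exact hz

end Scaling

/-! ### Scaling of the weighted norms and the inequality at unit scale. -/

section Norm

variable {d : ℕ} {X : Type*} [NormedAddCommGroup X]

theorem weightedLpNorm_eq {p : ℝ≥0∞} (hp0 : p ≠ 0) (hp : p ≠ ⊤) (γ : ℝ)
    (f : EuclideanSpace ℝ (Fin d) → X) : weightedLpNorm p γ f =
      (∫⁻ x, ‖f x‖ₑ ^ p.toReal * ENNReal.ofReal (‖x‖ ^ γ)) ^ (1 / p.toReal) := by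
  rw [weightedLpNorm, if_neg hp, eLpNorm_eq_lintegral_rpow_enorm_toReal hp0 hp,
    lintegral_withDensity_eq_lintegral_mul_non_measurable _
      (measurable_norm.pow_const _).ennreal_ofReal
      (Eventually.of_forall fun _ => ENNReal.ofReal_lt_top)]
  simp only [Pi.mul_apply, mul_comm]

theorem weightedLpNorm_comp_smul {p : ℝ≥0∞} (hp0 : p ≠ 0) (γ : ℝ)
    {f : EuclideanSpace ℝ (Fin d) → X} (hf : AEStronglyMeasurable f) {t : ℝ} (ht : 0 < t) :
    weightedLpNorm p γ (fun x => f (t • x)) =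
      ENNReal.ofReal (t ^ (-((d + γ) / p.toReal))) * weightedLpNorm p γ f := by
  by_cases hp : p = ⊤
  -- For `p = ∞` the exponent is a division by 0, so the factor is 1; dilation only rescales the
  -- measure, leaving essential suprema unchanged.
  · have hmap := Measure.map_addHaar_smul (volume : Measure (EuclideanSpace ℝ (Fin d))) ht.ne'
    have hc : ENNReal.ofReal |(t ^ Module.finrank ℝ (EuclideanSpace ℝ (Fin d)))⁻¹| ≠ 0 := by
      rw [ENNReal.ofReal_ne_zero_iff]
      positivity
    have hm : Measurable fun x : EuclideanSpace ℝ (Fin d) => t • x := measurable_const_smul t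
    have h := eLpNorm_map_measure (p := ⊤) (f := fun x : EuclideanSpace ℝ (Fin d) => t • x)
      (g := f) (μ := volume) (by rw [hmap]; exact hf.smul_measure _) hm.aemeasurable
    rw [hmap, eLpNorm_exponent_top, eLpNormEssSup_ennreal_smul_measure hc,
      ← eLpNorm_exponent_top] at h
    simp only [weightedLpNorm, hp, ENNReal.toReal_top, div_zero, neg_zero,
      Real.rpow_zero, ENNReal.ofReal_one, one_mul]
    exact h.symm
  · have hpr : 0 < p.toReal := ENNReal.toReal_pos hp0 hp
    rw [weightedLpNorm_eq hp0 hp, weightedLpNorm_eq hp0 hp]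
    have h1 : ∀ x : EuclideanSpace ℝ (Fin d),
        ‖f (t • x)‖ₑ ^ p.toReal * ENNReal.ofReal (‖x‖ ^ γ) =
        (fun z => ENNReal.ofReal (t ^ (-γ)) *
          (‖f z‖ₑ ^ p.toReal * ENNReal.ofReal (‖z‖ ^ γ))) (t • x) := fun x => by
      simp only [norm_smul, Real.norm_of_nonneg ht.le]
      rw [Real.mul_rpow ht.le (norm_nonneg _), ENNReal.ofReal_mul (by positivity),
        mul_left_comm, ← mul_assoc (ENNReal.ofReal (t ^ (-γ))),
        ← ENNReal.ofReal_mul (by positivity), ← Real.rpow_add ht, neg_add_cancel, Real.rpow_zero,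
        ENNReal.ofReal_one, one_mul]
    simp only [h1]
    rw [lintegral_comp_smul ht (fun z => ENNReal.ofReal (t ^ (-γ)) *
          (‖f z‖ₑ ^ p.toReal * ENNReal.ofReal (‖z‖ ^ γ))),
      lintegral_const_mul' _ _ ENNReal.ofReal_ne_top, ← mul_assoc,
      ← ENNReal.ofReal_mul (by positivity), ← Real.rpow_add ht,
      ENNReal.mul_rpow_of_nonneg _ _ (by positivity),
      ENNReal.ofReal_rpow_of_nonneg (by positivity) (by positivity), ← Real.rpow_mul ht.le,
      finrank_euclideanSpace_fin]
    congr 3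
    ring

theorem weightedLpNorm_const_smul [NormedSpace ℂ X] (p : ℝ≥0∞) (γ : ℝ) (c : ℂ)
    (f : EuclideanSpace ℝ (Fin d) → X) :
    weightedLpNorm p γ (fun x => c • f x) = ‖c‖ₑ * weightedLpNorm p γ f := by
  unfold weightedLpNorm
  split_ifs
  · exact eLpNorm_const_smul c f _ _
  · exact eLpNorm_const_smul c f _ _

/-- The weighted inequality at unit scale. -/
theorem exists_weightedLpNorm_corr_le [NormedSpace ℂ X] (hd : 1 ≤ d) {p₀ p₁ : ℝ≥0∞}
    (hp₀ : 1 < p₀) (hp₀' : p₀ ≠ ⊤) (hp₁ : 1 < p₁) {γ₀ γ₁ : ℝ} (hγ₁ : -(d : ℝ) < γ₁)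
    (hγ : γ₁ / p₁.toReal ≤ γ₀ / p₀.toReal)
    (hδ : (d + γ₁) / p₁.toReal < (d + γ₀) / p₀.toReal)
    (φ ψ : 𝓢(EuclideanSpace ℝ (Fin d), ℂ)) :
    ∃ C : ℝ≥0, ∀ f : EuclideanSpace ℝ (Fin d) → X, IsTemperedFun f → f =ᵐ[volume] corr φ f →
      weightedLpNorm p₁ γ₁ (corr ψ f) ≤ C * weightedLpNorm p₀ γ₀ f := by
  have : Nontrivial (EuclideanSpace ℝ (Fin d)) := by
    refine Module.nontrivial_of_finrank_pos (R := ℝ) ?_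
    rw [finrank_euclideanSpace_fin]
    exact hd
  have hfr : (Module.finrank ℝ (EuclideanSpace ℝ (Fin d)) : ℝ) = d := by
    rw [finrank_euclideanSpace_fin]
  set p := p₀.toReal with hp_def
  have hp : 1 < p := by
    simpa using (ENNReal.toReal_lt_toReal ENNReal.one_ne_top hp₀').mpr hp₀
  have hM : (Module.finrank ℝ (EuclideanSpace ℝ (Fin d)) : ℝ) < d + 1 := by rw [hfr]; linarith
  obtain ⟨C, hC⟩ := exists_enorm_corr_le (X := X) φ ψ hp γ₀ hM
  have hK : ∫⁻ y : EuclideanSpace ℝ (Fin d), bracket (d + 1) y ≠ ⊤ :=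
    (finite_integral_one_add_norm hM).ne
  set K : ℝ≥0 := (∫⁻ y : EuclideanSpace ℝ (Fin d), bracket (d + 1) y).toNNReal with hK_def
  have hwm : Measurable fun y : EuclideanSpace ℝ (Fin d) => ENNReal.ofReal (‖y‖ ^ γ₀) :=
    (measurable_norm.pow_const _).ennreal_ofReal
  have hV : ∀ f : EuclideanSpace ℝ (Fin d) → X, ∀ x,
      ∫⁻ y, bracket (d + 1) (y - x) * (‖f y‖ₑ ^ p * ENNReal.ofReal (‖y‖ ^ γ₀)) ≤
        ∫⁻ y, ‖f y‖ₑ ^ p * ENNReal.ofReal (‖y‖ ^ γ₀) := fun f x => by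
    refine lintegral_mono fun y => ?_
    exact mul_le_of_le_one_left zero_le (bracket_le_one (by positivity) _)
  have hp₀0 : p₀ ≠ 0 := (zero_lt_one.trans hp₀).ne'
  by_cases hp₁' : p₁ = ⊤
  · refine ⟨C, fun f hf hrep => ?_⟩
    have hγ₀ : 0 ≤ γ₀ / p := by
      simpa [hp₁'] using hγ
    rw [weightedLpNorm, if_pos hp₁', eLpNorm_exponent_top, weightedLpNorm_eq hp₀0 hp₀']
    refine eLpNormEssSup_le_of_ae_enorm_bound (Eventually.of_forall fun x => ?_)
    refine (hC f hf hrep x).trans ?_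
    calc _ ≤ C * 1 * (∫⁻ y, ‖f y‖ₑ ^ p * ENNReal.ofReal (‖y‖ ^ γ₀)) ^ (1 / p) := by
          gcongr ?_ * ?_
          · gcongr
            exact bracket_le_one hγ₀ x
          · exact ENNReal.rpow_le_rpow (hV f x) (by positivity)
      _ = _ := by rw [mul_one]
  · set q := p₁.toReal with hq_def
    have hp₁0 : p₁ ≠ 0 := (zero_lt_one.trans hp₁).ne'
    have hq : 0 < q := ENNReal.toReal_pos hp₁0 hp₁'
    obtain ⟨C', hC'⟩ := exists_lintegral_bracket_weight_le
      (E := EuclideanSpace ℝ (Fin d)) (p := p) (q := q) (γ₀ := γ₀) (γ₁ := γ₁) (by linarith) hq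
      (by rwa [hfr]) hγ (by rwa [hfr]) K
    refine ⟨C * C' ^ (1 / q), fun f hf hrep => ?_⟩
    set A : ℝ≥0∞ := ∫⁻ y, ‖f y‖ₑ ^ p * ENNReal.ofReal (‖y‖ ^ γ₀) with hA
    have hgm : AEMeasurable fun y => ‖f y‖ₑ ^ p * ENNReal.ofReal (‖y‖ ^ γ₀) :=
      (hf.1.enorm.pow_const p).mul hwm.aemeasurable
    obtain ⟨hVm, hVi⟩ := lintegral_lintegral_bracket_mul (M := d + 1) hgm
    have h1 := hC' _ A hVm (hV f) (by rw [hVi, hK_def, ENNReal.coe_toNNReal hK])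
    rw [weightedLpNorm_eq hp₁0 hp₁', weightedLpNorm_eq hp₀0 hp₀', ← hq_def, ← hp_def, ← hA]
    have h2 : ∫⁻ x, ‖corr ψ f x‖ₑ ^ q * ENNReal.ofReal (‖x‖ ^ γ₁) ≤
        (C : ℝ≥0∞) ^ q * (C' * A ^ (q / p)) := by
      refine le_trans ?_ (mul_le_mul_right h1 _)
      rw [← lintegral_const_mul' _ _ (by finiteness)]
      refine lintegral_mono fun x => ?_
      rw [← mul_assoc, ← ENNReal.mul_rpow_of_nonneg _ _ hq.le]
      gcongr
      rw [← mul_assoc]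
      exact hC f hf hrep x
    calc _ ≤ ((C : ℝ≥0∞) ^ q * (C' * A ^ (q / p))) ^ (1 / q) := by gcongr
      _ = _ := by
        rw [ENNReal.mul_rpow_of_nonneg _ _ (by positivity),
          ENNReal.mul_rpow_of_nonneg _ _ (by positivity), ← ENNReal.rpow_mul, ← ENNReal.rpow_mul,
          mul_one_div_cancel hq.ne', ENNReal.rpow_one]
        push_cast [ENNReal.coe_rpow_of_nonneg _ (by positivity : 0 ≤ 1 / q)]
        rw [← mul_assoc]
        congr 2
        field_simp

end Norm

end WeightedNikolskii

end

/-! ### The weighted inequality at arbitrary scale. -/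

theorem proposition4p1 (d : ℕ) (hd : 1 ≤ d)
    {X : Type*} [NormedAddCommGroup X] [NormedSpace ℂ X] [CompleteSpace X]
    (p₀ p₁ : ℝ≥0∞) (hp₀ : 1 < p₀) (hp₁ : 1 < p₁)
    (γ₀ γ₁ : ℝ) (hγ₀ : -(d : ℝ) < γ₀) (hγ₁ : -(d : ℝ) < γ₁)
    -- for `p = ∞` one has `p.toReal = 0` and `a / p.toReal = 0`, which is the usual `a / ∞ = 0`
    (hγ : γ₁ / p₁.toReal ≤ γ₀ / p₀.toReal)
    (hδ : (d + γ₁) / p₁.toReal < (d + γ₀) / p₀.toReal)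
    (α : Fin d → ℕ) :
    ∃ C : ℝ≥0, ∀ t : ℝ, 0 < t →
      ∀ (f : EuclideanSpace ℝ (Fin d) → X) (T : 𝓢'(EuclideanSpace ℝ (Fin d), X)),
        WeightedNikolskii.IsRepresentedBy T f →
        WeightedNikolskii.HasFourierSupportInBall T t →
        WeightedNikolskii.distLpNorm p₁ γ₁ (WeightedNikolskii.multiDeriv α T) ≤
          C * ENNReal.ofReal
              (t ^ (((∑ i, α i : ℕ) : ℝ) + ((d + γ₀) / p₀.toReal - (d + γ₁) / p₁.toReal))) *
            WeightedNikolskii.weightedLpNorm p₀ γ₀ f := by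
  open WeightedNikolskii in
  -- If `p₀ = ∞`, the right side of `hδ` is 0 while its left side is nonnegative.
  have hp₀' : p₀ ≠ ⊤ := by
    rintro rfl
    rw [ENNReal.toReal_top, div_zero] at hδ
    exact absurd hδ (not_lt.mpr (div_nonneg (by linarith) ENNReal.toReal_nonneg))
  have hp₀0 : p₀ ≠ 0 := (zero_lt_one.trans hp₀).ne'
  have hp : 1 < p₀.toReal := by
    simpa using (ENNReal.toReal_lt_toReal ENNReal.one_ne_top hp₀').mpr hp₀
  obtain ⟨φ, hφ⟩ := exists_fourierInv_eq_one (EuclideanSpace ℝ (Fin d)) (1 / (2 * Real.pi))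
  obtain ⟨C, hC⟩ := exists_weightedLpNorm_corr_le (X := X) hd hp₀ hp₀' hp₁ hγ₁ hγ hδ φ
    (kernelDeriv α φ)
  -- The added 1 keeps the constant nonzero, so that the right side is `⊤` when the norm of `f` is
  -- infinite.
  refine ⟨C + 1, fun t ht f T hT hsupp => ?_⟩
  set δ : ℝ := (d + γ₀) / p₀.toReal - (d + γ₁) / p₁.toReal with hδ_def
  by_cases hfin : weightedLpNorm p₀ γ₀ f = ⊤
  · rw [hfin, ENNReal.mul_top]
    · exact le_top
    · have : ENNReal.ofReal (t ^ (((∑ i, α i : ℕ) : ℝ) + δ)) ≠ 0 := by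
        rw [ENNReal.ofReal_ne_zero_iff]
        positivity
      exact mul_ne_zero (by simp) this
  have hft : IsTemperedFun f := by
    refine isTemperedFun_of_lintegral_lt_top hT.1 hp.le (γ := γ₀) ?_
    rw [weightedLpNorm_eq hp₀0 hp₀'] at hfin
    refine lt_top_iff_ne_top.mpr fun h => hfin ?_
    rw [h, ENNReal.top_rpow_of_pos (by positivity)]
  let u : ℝˣ := Units.mk0 t ht.ne'
  have hu : (u : ℝ) = t := rfl
  have hu0 : 0 < (u : ℝ) := ht
  have hconv : IsConvolved T u (Module.finrank ℝ (EuclideanSpace ℝ (Fin d))) T φ := by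
    intro η
    refine apply_eq_apply_conv hsupp (fun ξ hξ => ?_) η
    rw [fourierInv_dilate_apply hu0]
    refine hφ _ ?_
    rw [mem_ball_zero_iff] at hξ
    rw [norm_smul, norm_inv, Real.norm_of_nonneg hu0.le, hu, inv_mul_lt_iff₀ ht]
    rwa [mul_one_div]
  -- `f` and its correlation with the dilated kernel both represent `T`, hence agree almost
  -- everywhere; dilating gives the reproducing identity at unit scale.
  have hrep := ae_eq_corr_comp_inv_smul hu0 (hT.ae_eq (hconv.isRepresentedBy hT hft))
  have hft' := hft.comp_inv_smul ht
  refine (iInf₂_le _ ((hconv.multiDeriv α).isRepresentedBy hT hft)).trans ?_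
  have hcorr : corr (((u : ℝ) : ℂ) ^ (Module.finrank ℝ (EuclideanSpace ℝ (Fin d)) + ∑ i, α i) •
      dilate u (kernelDeriv α φ)) f = fun x => ((t : ℝ) : ℂ) ^ (∑ i, α i) •
        corr (kernelDeriv α φ) (fun z => f (t⁻¹ • z)) (t • x) :=
    funext fun x => corr_dilate hu0 _ _ f x
  rw [hcorr, weightedLpNorm_const_smul, weightedLpNorm_comp_smul (zero_lt_one.trans hp₁).ne' γ₁
    (hft'.locallyIntegrable_corr _).aestronglyMeasurable ht]
  have hbound := hC _ hft' hrep
  rw [weightedLpNorm_comp_smul hp₀0 γ₀ hft.1 (inv_pos.mpr ht)] at hbound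
  have htk : ‖((t : ℝ) : ℂ) ^ (∑ i, α i)‖ₑ = ENNReal.ofReal (t ^ ((∑ i, α i : ℕ) : ℝ)) := by
    rw [← ofReal_norm, norm_pow, Complex.norm_real, Real.norm_of_nonneg ht.le, Real.rpow_natCast]
  have hpow : t ^ (((∑ i, α i : ℕ) : ℝ) + δ) = t ^ ((∑ i, α i : ℕ) : ℝ) *
      (t ^ (-((d + γ₁) / p₁.toReal)) * t⁻¹ ^ (-((d + γ₀) / p₀.toReal))) := by
    rw [Real.inv_rpow ht.le, Real.rpow_neg ht.le ((d + γ₀) / p₀.toReal), inv_inv,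
      ← Real.rpow_add ht, ← Real.rpow_add ht, hδ_def]
    congr 1
    ring
  rw [htk, hpow, ENNReal.ofReal_mul (by positivity), ENNReal.ofReal_mul (by positivity)]
  calc _ ≤ ENNReal.ofReal (t ^ ((∑ i, α i : ℕ) : ℝ)) *
        (ENNReal.ofReal (t ^ (-((d + γ₁) / p₁.toReal))) * (((C + 1 : ℝ≥0) : ℝ≥0∞) *
          (ENNReal.ofReal (t⁻¹ ^ (-((d + γ₀) / p₀.toReal))) * weightedLpNorm p₀ γ₀ f))) := by
        gcongr
        refine hbound.trans ?_
        gcongr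
        exact_mod_cast le_self_add
    _ = _ := by ring
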